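/- Fix $d\in\mathbb{N}$, $c>0$, $p\in(1,\infty)$ and a potential $\phi\in C^2(\mathbb{R}^d;\mathbb{R})$; let $d\mu=e^{-\phi(x)}dx$ on $\mathbb{R}^d$. **Growth pairs.** A measurable $M:\mathbb{R}^d\to\mathbb{R}^d$ and $\epsilon\ge 0$ form a valid growth pair for $\phi$ and $p$ if for all $x,y\in\mathbb{R}^d$ $$\left|\;\left|\tfrac12-\tfrac1p\right||\phi(x)-\phi(y)|-\left|\tfrac{x-y}{c}\cdot M\!\left(\tfrac{x+y}{2c}\right)\right|\;\right|\le\epsilon .$$ **Symbols.** Let $\mathcal{D}_{\infty,1}$ be the space of measurable $g:\mathbb{R}^d\times\mathbb{R}^d\to\mathbb{C}$ (modulo null sets) for which there is a $G\in L^1(\mathbb{R}^d)$ dominating $g$, i.e. $|g(x,k)|<G(k)$ for a.e. $(x,k)$. Let $\mathcal{F}\varphi(k)=(2\pi)^{-d/2}\int_{\mathbb{R}^d}\varphi(\xi)e^{-i\xi\cdot k}d\xi$ for $\varphi\in\mathcal{S}(\mathbb{R}^d)$. The space $HS_0(M)$ consists of those $a\in L^\infty(\mathbb{R}^{2d})$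 for which there is a unique $g_a\in\mathcal{D}_{\infty,1}$ such that for a.e. $x\in\mathbb{R}^d$ and all $\varphi\in\mathcal{S}(\mathbb{R}^d)$ $$\int_{\mathbb{R}^d}a(x,\xi)\,\mathcal{F}\varphi(\xi)\,d\xi=(2\pi)^{d/2}\int_{\mathbb{R}^d}e^{-|M(x)\cdot k|}g_a(x,k)\varphi(k)\,dk ,$$ that is, the distributional Fourier transform of $a$ in its second variable is $\mathcal{F}_2a(x,k)=(2\pi)^{d/2}e^{-|M(x)\cdot k|}g_a(x,k)$. **Operators.** Let $\mathcal{C}_\phi=\{f:\mathbb{R}^d\to\mathbb{C}\;;\; fe^{-\phi/2}\in C_c^\infty(\mathbb{R}^d)\}$. For $a\in HS_0(M)$, $f\in\mathcal{C}_\phi$ and a.e. $y\in\mathbb{R}^d$ put $$(a(Q,P)f)(y)=\frac{1}{(2\pi)^{d/2}c^d}\int_{\mathbb{R}^d}\mathcal{F}_2a\!\left(\tfrac{x+y}{2c},\tfrac{x-y}{c}\right)e^{\frac12(\phi(y)-\phi(x))}f(x)\,dx .$$ **R-boundedness.** A set $\mathcal{T}$ of bounded operators on a Banach space $X$ is R-bounded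 if there is a constant $C$ such that for all $n$, all $T_1,\dots,T_n\in\mathcal{T}$ and $x_1,\dots,x_n\in X$, $$\Big(\mathbb{E}\big\|\textstyle\sum_i r_iT_ix_i\big\|^2\Big)^{1/2}\le C\Big(\mathbb{E}\big\|\textstyle\sum_i r_ix_i\big\|^2\Big)^{1/2},$$ where $r_1,\dots,r_n$ are independent random signs. **Theorem.** Let $(M,\epsilon)$ be a valid growth pair for $\phi$ and $p$, and let $A\subset HS_0(M)$. Suppose that for each $a\in A$ one can choose a $G_a\in L^1(\mathbb{R}^d)$ dominating $g_a$ such that $$\sup_{a\in A}\int_{\mathbb{R}^d}\operatorname*{ess\,sup}_{|y|\ge|x|}|G_a(y)|\,dx<\infty .$$ Then each $a(Q,P)$, $a\in A$, extends uniquely from $\mathcal{C}_\phi$ to a bounded operator on $L^p(\mu)$, and the set $\{a(Q,P)\;;\;a\in A\}$ of these extensions is R-bounded on $L^p(\mu)$. -/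

import Mathlib

open MeasureTheory
open scoped ENNReal RealInnerProductSpace SchwartzMap

noncomputable section

namespace GenWeyl

/-- Euclidean space `ℝ^d`. -/
abbrev Eucl (d : ℕ) : Type := EuclideanSpace ℝ (Fin d)

variable {d : ℕ}

/-! ### The weighted measure and the core -/

/-- The Borel measure `dμ = exp (-φ(x)) dx` on `ℝ^d`. -/
def weightedMeasure (φ : Eucl d → ℝ) : Measure (Eucl d) :=
  volume.withDensity fun x => ENNReal.ofReal (Real.exp (-φ x))

/-- The core `𝒞_φ`: the functions `f` for which `f · exp (-φ / 2)` is in `C_c^∞(ℝ^d)`. -/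
def core (φ : Eucl d → ℝ) : Set (Eucl d → ℂ) :=
  {f | ContDiff ℝ (⊤ : ℕ∞) (fun x => f x * (Real.exp (-φ x / 2) : ℂ)) ∧
    HasCompactSupport (fun x => f x * (Real.exp (-φ x / 2) : ℂ))}

/-- For a `C²` function `φ`, elements of the core belong to every `L^p(μ)`. -/
theorem memLp_of_mem_core {φ : Eucl d → ℝ} (hφ : ContDiff ℝ 2 φ) (p : ℝ≥0∞)
    {f : Eucl d → ℂ} (hf : f ∈ core φ) : MemLp f p (weightedMeasure φ) := by
  have hc : Continuous φ := hφ.continuous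
  have hloc : IsLocallyFiniteMeasure (weightedMeasure φ) :=
    IsLocallyFiniteMeasure.withDensity_ofReal (Real.continuous_exp.comp hc.neg)
  have heq : f = fun x => (f x * (Real.exp (-φ x / 2) : ℂ)) * (Real.exp (φ x / 2) : ℂ) := by
    funext x
    rw [mul_assoc, ← Complex.ofReal_mul, ← Real.exp_add]
    have : -φ x / 2 + φ x / 2 = 0 := by ring
    simp [this]
  have hcont : Continuous f := by
    rw [heq]
    exact hf.1.continuous.mul (by fun_prop)
  have hsupp : HasCompactSupport f := by
    rw [heq]
    exact hf.2.mul_right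
  exact hcont.memLp_of_hasCompactSupport hsupp

/-! ### The symbol class -/

/-- `G ∈ L¹(ℝ^d)` dominates `g`: `|g(x, k)| < G(k)` for almost every `(x, k)`. -/
def Dominates (G : Eucl d → ℝ) (g : Eucl d × Eucl d →ₘ[volume] ℂ) : Prop :=
  Integrable G ∧ ∀ᵐ z : Eucl d × Eucl d, ‖g z‖ < G z.2

/-- The space `𝒟_{∞,1}` of `L¹`-dominated functions on `ℝ^d × ℝ^d`, modulo equality almost
everywhere. (Domination implies `g ∈ L^∞(ℝ^d; L¹(ℝ^d))`.) -/
def DominatedSpace (d : ℕ) : Set (Eucl d × Eucl d →ₘ[volume] ℂ) :=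
  {g | ∃ G : Eucl d → ℝ, Dominates G g}

/-- The Fourier transform `(2π)^{-d/2} ∫ ϕ(ξ) exp (-i ξ·k) dξ` of a Schwartz function. -/
def fourierS (ϕ : 𝓢(Eucl d, ℂ)) (k : Eucl d) : ℂ :=
  (((2 * Real.pi) ^ (-(d : ℝ) / 2) : ℝ) : ℂ) *
    ∫ ξ : Eucl d, ϕ ξ * Complex.exp (-(Complex.I * ((⟪ξ, k⟫ : ℝ) : ℂ)))

/-- The pairing `⟨I_a(x), ψ⟩ = ∫ a(x, ξ) ψ(ξ) dξ`. -/
def sectionPairing (a : Lp ℂ ∞ (volume : Measure (Eucl d × Eucl d))) (x : Eucl d)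
    (ψ : Eucl d → ℂ) : ℂ :=
  ∫ ξ : Eucl d, a (x, ξ) * ψ ξ

/-- For almost every `x`, the Fourier transform of the tempered distribution `I_a(x)`, that is
`ϕ ↦ ⟨I_a(x), ℱϕ⟩`, is the function `k ↦ (2π)^{d/2} exp (-|M(x)·k|) g(x, k)`.
(Elements of `L^∞(ℝ^{2d})` are classes modulo null sets, so only almost every `x` is meaningful.) -/
def IsStripFactor (M : Eucl d → Eucl d) (a : Lp ℂ ∞ (volume : Measure (Eucl d × Eucl d)))
    (g : Eucl d × Eucl d →ₘ[volume] ℂ) : Prop :=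
  ∀ᵐ x : Eucl d, ∀ ϕ : 𝓢(Eucl d, ℂ),
    sectionPairing a x (fourierS ϕ) =
      (((2 * Real.pi) ^ ((d : ℝ) / 2) : ℝ) : ℂ) *
        ∫ k : Eucl d, (Real.exp (-|⟪M x, k⟫|) : ℂ) * g (x, k) * ϕ k

/-- The space `HS₀(M)` of holomorphic strip symbols. -/
def HS0 (M : Eucl d → Eucl d) : Set (Lp ℂ ∞ (volume : Measure (Eucl d × Eucl d))) :=
  {a | ∃! g : Eucl d × Eucl d →ₘ[volume] ℂ, g ∈ DominatedSpace d ∧ IsStripFactor M a g}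

/-- The function `g_a ∈ 𝒟_{∞,1}` associated with `a ∈ HS₀(M)`. -/
def stripFactor {M : Eucl d → Eucl d} (a : HS0 M) : Eucl d × Eucl d →ₘ[volume] ℂ :=
  a.2.choose

/-- `ℱ₂a(x, k) = (2π)^{d/2} exp (-|M(x)·k|) g_a(x, k)`. -/
def fourier2 {M : Eucl d → Eucl d} (a : HS0 M) (x k : Eucl d) : ℂ :=
  (((2 * Real.pi) ^ ((d : ℝ) / 2) : ℝ) : ℂ) * (Real.exp (-|⟪M x, k⟫|) : ℂ) *
    stripFactor a (x, k)

/-! ### The generalised Weyl calculus -/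

/-- The action of `a(Q, P)` on a function `f` of the core. -/
def weylAction (c : ℝ) (φ : Eucl d → ℝ) {M : Eucl d → Eucl d} (a : HS0 M)
    (f : Eucl d → ℂ) (y : Eucl d) : ℂ :=
  ((1 / ((2 * Real.pi) ^ ((d : ℝ) / 2) * c ^ d) : ℝ) : ℂ) *
    ∫ x : Eucl d, fourier2 a ((1 / (2 * c)) • (x + y)) ((1 / c) • (x - y)) *
      (Real.exp ((φ y - φ x) / 2) : ℂ) * f x

/-- `T` is a bounded operator on `L^p(μ)` which extends `a(Q, P)` from the core. -/
def IsWeylExtension (c : ℝ) {φ : Eucl d → ℝ} (hφ : ContDiff ℝ 2 φ) (p : ℝ≥0∞)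
    [Fact (1 ≤ p)] {M : Eucl d → Eucl d} (a : HS0 M)
    (T : Lp ℂ p (weightedMeasure φ) →L[ℂ] Lp ℂ p (weightedMeasure φ)) : Prop :=
  ∀ (f : Eucl d → ℂ) (hf : f ∈ core φ),
    T ((memLp_of_mem_core hφ p hf).toLp f) =ᵐ[weightedMeasure φ] weylAction c φ a f

/-- `(M, ε)` is a valid growth pair for `φ` and `p ∈ [1, ∞]` (with `1/∞ = 0`). -/
def IsValidGrowthPair (c : ℝ) (φ : Eucl d → ℝ) (p : ℝ≥0∞) (M : Eucl d → Eucl d)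
    (ε : ℝ) : Prop :=
  Measurable M ∧ 0 ≤ ε ∧ ∀ x y : Eucl d,
    |(|1 / 2 - (p⁻¹).toReal| * |φ x - φ y| -
      |⟪(1 / c) • (x - y), M ((1 / (2 * c)) • (x + y))⟫|)| ≤ ε

/-- `∫ esssup_{|y| ≥ |x|} |G(y)| dx`, the `L¹` norm of the least radially decreasing majorant. -/
def radialMajorantNorm (G : Eucl d → ℝ) : ℝ≥0∞ :=
  ∫⁻ x : Eucl d, essSup (fun y => ‖G y‖ₑ) (volume.restrict {y : Eucl d | ‖x‖ ≤ ‖y‖})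

/-! ### R-boundedness -/

section RBounded

variable {X Y : Type*} [NormedAddCommGroup X] [NormedSpace ℂ X]
  [NormedAddCommGroup Y] [NormedSpace ℂ Y]

/-- `(𝔼 ‖∑ᵢ rᵢ xᵢ‖²)^{1/2}` for independent random signs `rᵢ`: the expectation is the average
over all `2^n` choices of signs. -/
def rademacherNorm {n : ℕ} (x : Fin n → X) : ℝ :=
  Real.sqrt ((1 / 2 ^ n) * ∑ r : Fin n → ℤˣ, ‖∑ i, (((r i : ℤ) : ℂ)) • x i‖ ^ 2)

/-- R-boundedness of a family of bounded operators. -/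
def IsRBounded (𝒯 : Set (X →L[ℂ] Y)) : Prop :=
  ∃ C : ℝ, ∀ (n : ℕ) (T : Fin n → X →L[ℂ] Y) (x : Fin n → X), (∀ i, T i ∈ 𝒯) →
    rademacherNorm (fun i => T i (x i)) ≤ C * rademacherNorm x

end RBounded

end GenWeyl

end

set_option linter.unusedSectionVars false

namespace GenWeyl

open Set Metric Module

/-! ### The Hardy–Littlewood maximal function -/

section Maximal

variable {E : Type*} [NormedAddCommGroup E] [NormedSpace ℝ E] [MeasurableSpace E] [BorelSpace E]
  [FiniteDimensional ℝ E] (μ : Measure E) [μ.IsAddHaarMeasure]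

/-! Multiplication by `exp (-φ / p)` identifies `L^p(μ)` with the unweighted `L^p`. The growth
condition says that the decay `exp (-|M·k|)` of the symbol at the midpoint pays for the mismatch
between the factor `exp ((φ y - φ x) / 2)` in the kernel and the factor `exp ((φ y - φ x) / p)`
required by this identification, up to `exp ε` (`exp_growth_le`). After the substitution `x = y + c
z` the powers of `2π` and `c` cancel, and `a(Q, P)` is dominated pointwise by `exp ε` times the
positive convolution-type operator with kernel `|G_a|` (`weighted_weylAction_le`).

A kernel with integrable radially decreasing majorant gives an operator dominated by the maximal
function, with a constant depending only on the integral of the majorant (`kernelOp_le_maximalFn`).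
This yields a uniform square function estimate for families of such operators
(`exists_lintegral_square_kernelOp_le`). For `q ≥ 2`, Cauchy–Schwarz moves the square onto `u`, the
adjoint moves the operator onto a test weight, and the maximal inequality in the dual of `L^{q/2}`
finishes; the case `q < 2` follows by duality.

By Khintchine's inequality, combined with Minkowski's or Jensen's according to the side of 2 on
which `p` lies, the Rademacher norm in `L^p` is equivalent to the norm of the square function, so
the square function estimate is R-boundedness. The integral formula converges on all of `L^p(μ)`,
and the core is dense, so the unique bounded extension is given by that formula.

Several estimates have the form `X ≤ B * X ^ (1/q)` and are closed by dividing. This requires `X` to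
be finite beforehand, which is the role of the crude bounds with constants depending on `n`. -/

/-- The uncentred Hardy–Littlewood maximal function. -/
noncomputable def maximalFn (u : E → ℝ≥0∞) (y : E) : ℝ≥0∞ :=
  ⨆ b : E × ℝ, ⨆ _ : y ∈ ball b.1 b.2, (∫⁻ z in ball b.1 b.2, u z ∂μ) / μ (ball b.1 b.2)

theorem div_le_maximalFn (u : E → ℝ≥0∞) {x y : E} {r : ℝ} (h : y ∈ ball x r) :
    (∫⁻ z in ball x r, u z ∂μ) / μ (ball x r) ≤ maximalFn μ u y :=
  le_iSup₂_of_le (x, r) h le_rfl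

theorem lintegral_ball_le_maximalFn (u : E → ℝ≥0∞) {x y : E} {r : ℝ} (h : y ∈ ball x r) :
    ∫⁻ z in ball x r, u z ∂μ ≤ μ (ball x r) * maximalFn μ u y := by
  have h0 : μ (ball x r) ≠ 0 := (isOpen_ball.measure_pos μ ⟨y, h⟩).ne'
  calc _ = μ (ball x r) * ((∫⁻ z in ball x r, u z ∂μ) / μ (ball x r)) :=
        (ENNReal.mul_div_cancel h0 measure_ball_lt_top.ne).symm
    _ ≤ _ := by gcongr; exact div_le_maximalFn μ u h

/-- Because the maximal function is uncentred, a ball with large average lies entirely in the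
superlevel set. This gives openness, without measurability of `u`, and the family for Vitali's
covering lemma. -/
theorem setOf_lt_maximalFn (u : E → ℝ≥0∞) (t : ℝ≥0∞) :
    {y | t < maximalFn μ u y} =
      ⋃ b ∈ {b : E × ℝ | t < (∫⁻ z in ball b.1 b.2, u z ∂μ) / μ (ball b.1 b.2)},
        ball b.1 b.2 := by
  ext y
  simp [maximalFn, lt_iSup_iff, and_comm]

theorem isOpen_setOf_lt_maximalFn (u : E → ℝ≥0∞) (t : ℝ≥0∞) :
    IsOpen {y | t < maximalFn μ u y} := by
  rw [setOf_lt_maximalFn]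
  exact isOpen_biUnion fun _ _ => isOpen_ball

theorem measurable_maximalFn (u : E → ℝ≥0∞) : Measurable (maximalFn μ u) :=
  measurable_of_Ioi fun t => (isOpen_setOf_lt_maximalFn μ u t).measurableSet

theorem maximalFn_one_le (y : E) : maximalFn μ (fun _ => 1) y ≤ 1 := by
  refine iSup₂_le fun b _ => ?_
  rw [setLIntegral_one]
  exact ENNReal.div_self_le_one

/-- The form of sublinearity needed to truncate `u` at a fixed height. -/
theorem maximalFn_le_add {u v : E → ℝ≥0∞} {s : ℝ≥0∞} (h : ∀ x, u x ≤ v x + s) (y : E) :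
    maximalFn μ u y ≤ maximalFn μ v y + s := by
  refine iSup₂_le fun b hb => ?_
  calc _ ≤ (∫⁻ z in ball b.1 b.2, (v z + s) ∂μ) / μ (ball b.1 b.2) := by
        gcongr; exact h _
    _ = (∫⁻ z in ball b.1 b.2, v z ∂μ) / μ (ball b.1 b.2)
        + s * μ (ball b.1 b.2) / μ (ball b.1 b.2) := by
        rw [lintegral_add_right _ measurable_const, setLIntegral_const, ENNReal.add_div]
    _ ≤ _ := by
        gcongr
        · exact div_le_maximalFn μ v hb
        · rw [mul_div_assoc]
          exact mul_le_of_le_one_right' ENNReal.div_self_le_one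

/-- A union of balls of bounded radius on which `u` has average more than `t` is small. -/
theorem mul_measure_biUnion_ball_le (u : E → ℝ≥0∞) (t : ℝ≥0∞) (s : Set (E × ℝ)) (R : ℝ)
    (hR : ∀ b ∈ s, b.2 ≤ R)
    (hs : ∀ b ∈ s, t * μ (ball b.1 b.2) ≤ ∫⁻ z in ball b.1 b.2, u z ∂μ) :
    t * μ (⋃ b ∈ s, ball b.1 b.2) ≤ 4 ^ finrank ℝ E * ∫⁻ z, u z ∂μ := by
  -- Restricting to positive radii makes the selected balls nonempty, so disjointness forces
  -- countability. The enlargement factor 4 is the source of `4 ^ finrank ℝ E`.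
  obtain ⟨w, hws, hdisj, hcov⟩ :=
    Vitali.exists_disjoint_subfamily_covering_enlargement_ball {b ∈ s | 0 < b.2}
      (fun b => b.1) (fun b => b.2) R (fun b hb => hR b hb.1) 4 (by norm_num)
  have hcount : w.Countable := hdisj.countable_of_isOpen (fun _ _ => isOpen_ball)
    fun b hb => nonempty_ball.2 (hws hb).2
  have hsub : (⋃ b ∈ s, ball b.1 b.2) ⊆ ⋃ b ∈ w, ball b.1 (4 * b.2) := by
    refine iUnion₂_subset fun b hb => ?_
    rcases le_or_gt b.2 0 with h0 | h0
    · simp [ball_eq_empty.2 h0]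
    · obtain ⟨b', hb', h⟩ := hcov b ⟨hb, h0⟩
      exact h.trans (subset_biUnion_of_mem (u := fun b : E × ℝ => ball b.1 (4 * b.2)) hb')
  calc t * μ (⋃ b ∈ s, ball b.1 b.2)
      ≤ t * ∑' b : w, μ (ball b.1.1 (4 * b.1.2)) := by
        gcongr
        exact (measure_mono hsub).trans (measure_biUnion_le μ hcount _)
    _ = 4 ^ finrank ℝ E * ∑' b : w, t * μ (ball b.1.1 b.1.2) := by
        rw [← ENNReal.tsum_mul_left, ← ENNReal.tsum_mul_left]
        refine tsum_congr fun b => ?_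
        rw [Measure.addHaar_ball_mul_of_pos μ _ (by norm_num : (0 : ℝ) < 4),
          Measure.addHaar_ball_center μ b.1.1, ENNReal.ofReal_pow (by norm_num)]
        norm_num
        ring
    _ ≤ 4 ^ finrank ℝ E * ∑' b : w, ∫⁻ z in ball b.1.1 b.1.2, u z ∂μ := by
        gcongr with b
        exact hs _ (hws b.2).1
    _ = 4 ^ finrank ℝ E * ∫⁻ z in ⋃ b ∈ w, ball b.1 b.2, u z ∂μ := by
        rw [lintegral_biUnion hcount (fun _ _ => measurableSet_ball) hdisj]
    _ ≤ _ := by gcongr; exact Measure.restrict_le_self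

/-- The weak type `(1, 1)` inequality for the maximal function. -/
theorem mul_measure_lt_maximalFn_le (u : E → ℝ≥0∞) (t : ℝ≥0∞) :
    t * μ {y | t < maximalFn μ u y} ≤ 4 ^ finrank ℝ E * ∫⁻ z, u z ∂μ := by
  -- Vitali's lemma needs bounded radii, so the superlevel set is exhausted by balls of radius at
  -- most `n`.
  set s : ℕ → Set (E × ℝ) := fun n =>
    {b | b.2 ≤ n ∧ t < (∫⁻ z in ball b.1 b.2, u z ∂μ) / μ (ball b.1 b.2)}
  have hU : {y | t < maximalFn μ u y} = ⋃ n, ⋃ b ∈ s n, ball b.1 b.2 := by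
    rw [setOf_lt_maximalFn]
    ext y
    simp only [mem_iUnion, exists_prop, s, mem_ofPred_eq]
    constructor
    · rintro ⟨b, hb, hy⟩
      obtain ⟨n, hn⟩ := exists_nat_ge b.2
      exact ⟨n, b, ⟨hn, hb⟩, hy⟩
    · rintro ⟨n, b, hb, hy⟩
      exact ⟨b, hb.2, hy⟩
  have hmono : Monotone fun n => ⋃ b ∈ s n, ball b.1 b.2 := by
    intro m n hmn
    refine biUnion_subset_biUnion_left fun b hb => ⟨hb.1.trans (by exact_mod_cast hmn), hb.2⟩
  rw [hU, hmono.measure_iUnion, ENNReal.mul_iSup]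
  refine iSup_le fun n => mul_measure_biUnion_ball_le μ u t (s n) n (fun b hb => hb.1) fun b hb => ?_
  exact ENNReal.mul_le_of_le_div hb.2.le

theorem lintegral_Ioo_rpow {q : ℝ} (hq : 0 < q) {x : ℝ} (hx : 0 ≤ x) :
    ∫⁻ t in Ioo 0 x, ENNReal.ofReal (q * t ^ (q - 1)) = ENNReal.ofReal (x ^ q) := by
  -- The layer cake formula for a constant function on a one-point probability space.
  have h := lintegral_rpow_eq_lintegral_meas_lt_mul (Measure.dirac ()) (f := fun _ => x)
    (ae_of_all _ fun _ => hx) aemeasurable_const hq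
  rw [lintegral_const, Measure.dirac_apply_of_mem (mem_univ _), mul_one] at h
  rw [h, ← lintegral_const_mul' _ _ ENNReal.ofReal_ne_top, ← Ioi_inter_Iio, inter_comm,
    ← setLIntegral_indicator measurableSet_Iio]
  refine lintegral_congr fun t => ?_
  by_cases ht : t < x
  · simp [ht, ENNReal.ofReal_mul hq.le]
  · simp [ht]

/-- The layer cake formula for a power of an extended nonnegative number. -/
theorem rpow_eq_lintegral_indicator {q : ℝ} (hq : 0 < q) (x : ℝ≥0∞) :
    x ^ q = ∫⁻ t in Ioi (0 : ℝ),
      {t : ℝ | ENNReal.ofReal t < x}.indicator (fun t => ENNReal.ofReal (q * t ^ (q - 1))) t := by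
  have hm : MeasurableSet {t : ℝ | ENNReal.ofReal t < x} :=
    measurableSet_lt ENNReal.measurable_ofReal measurable_const
  rw [setLIntegral_indicator hm]
  rcases eq_or_ne x ∞ with rfl | hx
  · rw [ENNReal.top_rpow_of_pos hq, eq_comm]
    refine ENNReal.eq_top_of_forall_nnreal_le fun r => ?_
    have h0 : (0 : ℝ) ≤ (r : ℝ) ^ q⁻¹ := by positivity
    calc (r : ℝ≥0∞) = ENNReal.ofReal (((r : ℝ) ^ q⁻¹) ^ q) := by
          rw [← Real.rpow_mul (NNReal.coe_nonneg r), inv_mul_cancel₀ hq.ne', Real.rpow_one]; simp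
      _ = ∫⁻ t in Ioo 0 ((r : ℝ) ^ q⁻¹), ENNReal.ofReal (q * t ^ (q - 1)) :=
          (lintegral_Ioo_rpow hq h0).symm
      _ ≤ _ := lintegral_mono_set (μ := volume)
          fun t ht => show t ∈ _ ∩ _ from ⟨ENNReal.ofReal_lt_top, ht.1⟩
  · lift x to NNReal using hx
    have : {t : ℝ | ENNReal.ofReal t < x} ∩ Ioi 0 = Ioo 0 (x : ℝ) := by
      ext t
      simp only [mem_inter_iff, mem_ofPred_eq, mem_Ioi, mem_Ioo]
      constructor
      · rintro ⟨h1, h2⟩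
        refine ⟨h2, ?_⟩
        rwa [← ENNReal.ofReal_coe_nnreal, ENNReal.ofReal_lt_ofReal_iff_of_nonneg h2.le] at h1
      · rintro ⟨h1, h2⟩
        refine ⟨?_, h1⟩
        rwa [← ENNReal.ofReal_coe_nnreal, ENNReal.ofReal_lt_ofReal_iff_of_nonneg h1.le]
    rw [this, lintegral_Ioo_rpow hq (NNReal.coe_nonneg x), ← ENNReal.ofReal_rpow_of_nonneg (NNReal.coe_nonneg x) hq.le]
    simp

/-- The part of `u` below `t / 2` contributes at most `t / 2` to the maximal function, so the weak
type bound at height `t / 2` is needed only for the part above. This localisation turns weak type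
into strong type. -/
theorem measure_lt_maximalFn_le (u : E → ℝ≥0∞) {t : ℝ} (ht : 0 < t) :
    μ {y | ENNReal.ofReal t < maximalFn μ u y} ≤
      ENNReal.ofReal (2 / t) * (4 ^ finrank ℝ E *
        ∫⁻ z, {z | ENNReal.ofReal t < 2 * u z}.indicator u z ∂μ) := by
  set v : E → ℝ≥0∞ := {z | ENNReal.ofReal t < 2 * u z}.indicator u
  have htwo : ENNReal.ofReal t = ENNReal.ofReal (t / 2) + ENNReal.ofReal (t / 2) := by
    rw [← ENNReal.ofReal_add (by positivity) (by positivity)]; ring_nf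
  have hle : ∀ x, u x ≤ v x + ENNReal.ofReal (t / 2) := by
    intro x
    by_cases hx : ENNReal.ofReal t < 2 * u x
    · simp [v, hx]
    · simp only [v, indicator, mem_ofPred_eq, hx, if_false, zero_add]
      rw [not_lt, htwo, two_mul] at hx
      by_contra! h
      exact absurd hx (not_le.2 (ENNReal.add_lt_add h h))
  have hsub : {y | ENNReal.ofReal t < maximalFn μ u y} ⊆
      {y | ENNReal.ofReal (t / 2) < maximalFn μ v y} := by
    intro y hy
    simp only [mem_ofPred_eq] at hy ⊢
    have := hy.trans_le (maximalFn_le_add μ hle y)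
    rw [htwo] at this
    exact lt_of_add_lt_add_right this
  have h := mul_measure_lt_maximalFn_le μ v (ENNReal.ofReal (t / 2))
  calc _ ≤ μ {y | ENNReal.ofReal (t / 2) < maximalFn μ v y} := measure_mono hsub
    _ = ENNReal.ofReal (2 / t) * (ENNReal.ofReal (t / 2) *
          μ {y | ENNReal.ofReal (t / 2) < maximalFn μ v y}) := by
        rw [← mul_assoc, ← ENNReal.ofReal_mul (by positivity)]
        have : 2 / t * (t / 2) = 1 := by field_simp
        rw [this]; simp
    _ ≤ _ := by gcongr

/-- The **Hardy–Littlewood maximal inequality** in `L^q`, `1 < q < ∞`. -/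
theorem exists_lintegral_maximalFn_rpow_le {q : ℝ} (hq : 1 < q) :
    ∃ C : ℝ≥0∞, C ≠ ∞ ∧ ∀ u : E → ℝ≥0∞, Measurable u →
      ∫⁻ y, maximalFn μ u y ^ q ∂μ ≤ C * ∫⁻ y, u y ^ q ∂μ := by
  have hq0 : 0 < q := by linarith
  have hq1 : 0 < q - 1 := by linarith
  set K : ℝ≥0∞ := ENNReal.ofReal (2 * q / (q - 1)) * 4 ^ finrank ℝ E
  refine ⟨K * 2 ^ (q - 1), by finiteness, fun u hu => ?_⟩
  have hmeas : ∀ (w : E → ℝ≥0∞) (s : ℝ), Measurable w → Measurable fun z : E × ℝ =>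
      {t : ℝ | ENNReal.ofReal t < w z.1}.indicator
        (fun t => ENNReal.ofReal (s * t ^ (s - 1))) z.2 := by
    intro w s hw
    have : Measurable fun z : E × ℝ => ENNReal.ofReal (s * z.2 ^ (s - 1)) := by fun_prop
    exact this.indicator
      (measurableSet_lt (ENNReal.measurable_ofReal.comp measurable_snd) (hw.comp measurable_fst))
  calc ∫⁻ y, maximalFn μ u y ^ q ∂μ
      = ∫⁻ y, (∫⁻ t in Ioi (0 : ℝ), {t : ℝ | ENNReal.ofReal t < maximalFn μ u y}.indicator
          (fun t => ENNReal.ofReal (q * t ^ (q - 1))) t) ∂μ :=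
        lintegral_congr fun y => rpow_eq_lintegral_indicator hq0 _
    _ = ∫⁻ t in Ioi (0 : ℝ), ∫⁻ y, {t : ℝ | ENNReal.ofReal t < maximalFn μ u y}.indicator
          (fun t => ENNReal.ofReal (q * t ^ (q - 1))) t ∂μ :=
        lintegral_lintegral_swap (hmeas _ q (measurable_maximalFn μ u)).aemeasurable
    -- The factor `2 / t` from the weak type bound lowers the exponent by one; `K` is normalised so
    -- that the remaining density is that of the layer cake formula for the power `q - 1`, here of
    -- `2 * u`.
    _ ≤ ∫⁻ t in Ioi (0 : ℝ), ∫⁻ y, K * u y * {t : ℝ | ENNReal.ofReal t < 2 * u y}.indicator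
          (fun t => ENNReal.ofReal ((q - 1) * t ^ (q - 1 - 1))) t ∂μ := by
        refine setLIntegral_mono' measurableSet_Ioi fun t ht => ?_
        have ht : 0 < t := ht
        calc _ = ENNReal.ofReal (q * t ^ (q - 1)) *
              μ {y | ENNReal.ofReal t < maximalFn μ u y} := by
              rw [← lintegral_indicator_const (isOpen_setOf_lt_maximalFn μ u _).measurableSet]
              rfl
          _ ≤ ENNReal.ofReal (q * t ^ (q - 1)) * (ENNReal.ofReal (2 / t) * (4 ^ finrank ℝ E *
                ∫⁻ z, {z | ENNReal.ofReal t < 2 * u z}.indicator u z ∂μ)) := by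
              gcongr; exact measure_lt_maximalFn_le μ u ht
          _ = (K * ENNReal.ofReal ((q - 1) * t ^ (q - 1 - 1))) *
                ∫⁻ z, {z | ENNReal.ofReal t < 2 * u z}.indicator u z ∂μ := by
              have : q * t ^ (q - 1) * (2 / t) =
                  2 * q / (q - 1) * ((q - 1) * t ^ (q - 1 - 1)) := by
                rw [Real.rpow_sub_one ht.ne' (q - 1)]; field_simp
              simp only [K]
              rw [← mul_assoc, ← ENNReal.ofReal_mul (by positivity), this,
                ENNReal.ofReal_mul (by positivity)]
              ring
          _ = _ := by
              rw [← lintegral_const_mul _ (hu.indicator (measurableSet_lt measurable_const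
                (hu.const_mul 2)))]
              refine lintegral_congr fun y => ?_
              by_cases hy : ENNReal.ofReal t < 2 * u y
              · simp [hy]; ring
              · simp [hy]
    _ = ∫⁻ y, (∫⁻ t in Ioi (0 : ℝ), K * u y * {t : ℝ | ENNReal.ofReal t < 2 * u y}.indicator
          (fun t => ENNReal.ofReal ((q - 1) * t ^ (q - 1 - 1))) t) ∂μ := by
        refine (lintegral_lintegral_swap ?_).symm
        exact (((hu.comp measurable_fst).const_mul K).mul
          (hmeas _ (q - 1) (hu.const_mul 2))).aemeasurable
    _ = ∫⁻ y, K * u y * (2 * u y) ^ (q - 1) ∂μ := by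
        refine lintegral_congr fun y => ?_
        rw [rpow_eq_lintegral_indicator hq1, lintegral_const_mul]
        exact (hmeas _ (q - 1) (hu.const_mul 2)).comp measurable_prodMk_left
    _ = K * 2 ^ (q - 1) * ∫⁻ y, u y ^ q ∂μ := by
        rw [← lintegral_const_mul _ (hu.pow_const q)]
        refine lintegral_congr fun y => ?_
        rw [ENNReal.mul_rpow_of_nonneg _ _ hq1.le]
        have : u y ^ q = u y * u y ^ (q - 1) := by
          conv_lhs => rw [show q = 1 + (q - 1) by ring,
            ENNReal.rpow_add_of_nonneg _ _ zero_le_one hq1.le, ENNReal.rpow_one]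
        rw [this]; ring

end Maximal

/-! ### Positive convolution operators with radially dominated kernels -/

section Kernel

variable {E : Type*} [NormedAddCommGroup E] [NormedSpace ℝ E] [MeasurableSpace E] [BorelSpace E]
  [FiniteDimensional ℝ E] (μ : Measure E) [μ.IsAddHaarMeasure]

/-- The positive operator `u ↦ ∫ k(z) u(y + c z) dz`. -/
noncomputable def kernelOp (k : E → ℝ≥0∞) (c : ℝ) (u : E → ℝ≥0∞) (y : E) : ℝ≥0∞ :=
  ∫⁻ z, k z * u (y + c • z) ∂μ

/-- The integral of the least radially decreasing majorant of `k`. -/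
noncomputable def majorantIntegral (k : E → ℝ≥0∞) : ℝ≥0∞ :=
  ∫⁻ x, essSup k (μ.restrict {y : E | ‖x‖ ≤ ‖y‖}) ∂μ

theorem lintegral_comp_add_smul (f : E → ℝ≥0∞) (y : E) {c : ℝ} (hc : c ≠ 0) :
    ∫⁻ z, f (y + c • z) ∂μ = ENNReal.ofReal |(c ^ finrank ℝ E)⁻¹| * ∫⁻ z, f z ∂μ := by
  have h := lintegral_map_equiv (μ := μ) (fun z => f (y + z))
    (Homeomorph.smulOfNeZero c hc).toMeasurableEquiv
  calc _ = ∫⁻ z, f (y + z) ∂(μ.map (c • ·)) := h.symm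
    _ = _ := by
      rw [Measure.map_addHaar_smul μ hc, lintegral_smul_measure, lintegral_add_left_eq_self]
      rfl

theorem setLIntegral_ball_comp_le (u : E → ℝ≥0∞) (y : E) {c : ℝ} (hc : c ≠ 0) {r : ℝ}
    (hr : 0 < r) :
    ∫⁻ z in ball 0 r, u (y + c • z) ∂μ ≤ μ (ball 0 r) * maximalFn μ u y := by
  have hcr : 0 < |c| * r := by positivity
  have hind : ∀ v : E → ℝ≥0∞, ∫⁻ z in ball 0 r, v (y + c • z) ∂μ =
      ENNReal.ofReal |(c ^ finrank ℝ E)⁻¹| * ∫⁻ z in ball y (|c| * r), v z ∂μ := by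
    intro v
    rw [← lintegral_indicator measurableSet_ball, ← lintegral_indicator measurableSet_ball,
      ← lintegral_comp_add_smul μ _ y hc]
    refine lintegral_congr fun z => ?_
    have : z ∈ ball (0 : E) r ↔ y + c • z ∈ ball y (|c| * r) := by
      simp [norm_smul, hc]
    by_cases hz : z ∈ ball (0 : E) r
    · rw [indicator_of_mem hz, indicator_of_mem (this.1 hz)]
    · rw [indicator_of_notMem hz, indicator_of_notMem (fun h => hz (this.2 h))]
  -- The case `v = 1` relates the volumes of the two balls, so the Jacobian cancels without being
  -- computed.
  have h1 := hind fun _ => 1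
  rw [setLIntegral_one, setLIntegral_one] at h1
  rw [hind u, h1, mul_assoc]
  gcongr
  exact lintegral_ball_le_maximalFn μ u (mem_ball_self hcr)

/-- In dimension at least one, doubling the radius at least doubles the volume. -/
theorem measure_ball_le_annulus [Nontrivial E] {r : ℝ} (hr : 0 < r) :
    μ (ball (0 : E) r) ≤ μ {x : E | r ≤ ‖x‖ ∧ ‖x‖ < 2 * r} := by
  have h2 : 2 * μ (ball (0 : E) r) ≤ μ (ball (0 : E) (2 * r)) := by
    rw [Measure.addHaar_ball_mul_of_pos μ _ (by norm_num : (0 : ℝ) < 2)]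
    gcongr
    have : (2 : ℝ) ≤ 2 ^ finrank ℝ E := by
      calc (2 : ℝ) = 2 ^ 1 := by norm_num
        _ ≤ _ := pow_le_pow_right₀ (by norm_num) finrank_pos
    calc (2 : ℝ≥0∞) = ENNReal.ofReal 2 := by simp
      _ ≤ _ := ENNReal.ofReal_le_ofReal this
  have h3 : μ (ball (0 : E) (2 * r)) ≤
      μ (ball (0 : E) r) + μ {x : E | r ≤ ‖x‖ ∧ ‖x‖ < 2 * r} := by
    refine (measure_mono fun x hx => ?_).trans (measure_union_le _ _)
    rw [mem_ball_zero_iff] at hx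
    rcases lt_or_ge ‖x‖ r with h | h
    · exact Or.inl (by simpa using h)
    · exact Or.inr ⟨h, hx⟩
  rw [two_mul] at h2
  exact (ENNReal.add_le_add_iff_left measure_ball_lt_top.ne).1 (h2.trans h3)

/-- Convolution with a radially dominated kernel is controlled by the maximal function. -/
theorem kernelOp_le_maximalFn (k : E → ℝ≥0∞) {c : ℝ} (hc : c ≠ 0) {u : E → ℝ≥0∞}
    (hu : Measurable u) (y : E) :
    kernelOp μ k c u y ≤ 4 ^ finrank ℝ E * majorantIntegral μ k * maximalFn μ u y := by
  have hae : ∀ r : ℝ, ∀ᵐ z ∂μ, r ≤ ‖z‖ → k z ≤ essSup k (μ.restrict {y : E | r ≤ ‖y‖}) := by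
    intro r
    have hm : MeasurableSet {y : E | r ≤ ‖y‖} := measurableSet_le measurable_const measurable_norm
    exact (ae_restrict_iff' hm).1 (ENNReal.ae_le_essSup k)
  cases subsingleton_or_nontrivial E with
  | inl hE =>
    -- In dimension zero the origin has positive mass and the annuli below are empty. Here `E` is a
    -- point and `u` equals its own average.
    have hmax : ∀ z : E, u (y + c • z) ≤ maximalFn μ u y := by
      intro z
      have hb : ball y 1 = univ := by
        ext w; simp [Subsingleton.elim w y]
      have h := div_le_maximalFn μ u (mem_ball_self (x := y) one_pos)
      have hu : (fun w => u w) = fun _ => u (y + c • z) := by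
        ext w; rw [Subsingleton.elim w (y + c • z)]
      have h0 : μ (ball y 1) ≠ 0 := (measure_ball_pos μ y one_pos).ne'
      rwa [hu, setLIntegral_const, ENNReal.mul_div_cancel_right h0 measure_ball_lt_top.ne] at h
    have h4 : (1 : ℝ≥0∞) ≤ 4 ^ finrank ℝ E := one_le_pow₀ (by norm_num)
    calc kernelOp μ k c u y
        ≤ ∫⁻ z, essSup k (μ.restrict {y : E | ‖z‖ ≤ ‖y‖}) * maximalFn μ u y ∂μ := by
          refine lintegral_mono_ae ?_
          filter_upwards [hae 0] with z hz
          have : ‖z‖ = 0 := by simp [Subsingleton.elim z 0]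
          rw [this]
          exact mul_le_mul' (hz (norm_nonneg z)) (hmax z)
      _ = majorantIntegral μ k * maximalFn μ u y := by
          have : ∀ z : E, z = 0 := fun z => Subsingleton.elim z 0
          have hf : Measurable fun z : E => essSup k (μ.restrict {y : E | ‖z‖ ≤ ‖y‖}) :=
            measurable_const' fun y z => by rw [this y, this z]
          rw [lintegral_mul_const _ hf]; rfl
      _ ≤ _ := by
          gcongr
          exact le_mul_of_one_le_left' h4
  | inr hE =>
    set Ψ : ℝ → ℝ≥0∞ := fun r => essSup k (μ.restrict {y : E | r ≤ ‖y‖})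
    have hΨ : Antitone Ψ := fun r s hrs =>
      essSup_mono_measure' (Measure.restrict_mono (fun y hy => hrs.trans hy) le_rfl)
    set A : ℤ → Set E := fun j => {x | (2 : ℝ) ^ j ≤ ‖x‖ ∧ ‖x‖ < 2 * 2 ^ j}
    have hA : ∀ j, MeasurableSet (A j) := fun j =>
      (measurableSet_le measurable_const measurable_norm).inter
        (measurableSet_lt measurable_norm measurable_const)
    have hAdisj : Pairwise (Function.onFun Disjoint A) := by
      have key : ∀ i j : ℤ, i < j → Disjoint (A i) (A j) := by
        intro i j hij
        refine disjoint_left.2 fun x hi hj => ?_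
        have : (2 : ℝ) ^ (i + 1) ≤ 2 ^ j := zpow_le_zpow_right₀ (by norm_num) hij
        rw [zpow_add_one₀ (by norm_num)] at this
        linarith [hi.2, hj.1]
      intro i j hij
      rcases lt_or_gt_of_ne hij with h | h
      · exact key i j h
      · exact (key j i h).symm
    have hcover : ∀ᵐ z ∂μ, z ∈ ⋃ j, A j := by
      have h0 : ∀ᵐ z ∂μ, z ≠ (0 : E) := by
        rw [ae_iff]; simp
      filter_upwards [h0] with z hz
      obtain ⟨j, hj⟩ := exists_mem_Ico_zpow (norm_pos_iff.2 hz) one_lt_two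
      rw [mem_iUnion]
      refine ⟨j, hj.1, ?_⟩
      have := hj.2
      rw [zpow_add_one₀ (by norm_num)] at this
      linarith
    -- On `A j` the kernel is at most `Ψ (2 ^ j)`, while on the next smaller annulus `A (j - 1)` the
    -- majorant is at least `Ψ (2 ^ j)`. The volume of the ball containing `A j` is at most `4 ^
    -- finrank ℝ E` times that of `A (j - 1)`, so the bound becomes an integral of the majorant one
    -- annulus further in.
    have hstep : ∀ j : ℤ, ∫⁻ z in A j, k z * u (y + c • z) ∂μ ≤
        4 ^ finrank ℝ E * (∫⁻ x in A (j - 1), Ψ ‖x‖ ∂μ) * maximalFn μ u y := by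
      intro j
      have hj : (0 : ℝ) < 2 ^ j := by positivity
      have hj1 : (0 : ℝ) < 2 ^ (j - 1) := by positivity
      have hjj : (2 : ℝ) ^ j = 2 * 2 ^ (j - 1) := by
        rw [zpow_sub_one₀ (by norm_num)]; ring
      calc ∫⁻ z in A j, k z * u (y + c • z) ∂μ
          ≤ ∫⁻ z in A j, Ψ (2 ^ j) * u (y + c • z) ∂μ := by
            refine setLIntegral_mono_ae' (hA j) ?_
            filter_upwards [hae (2 ^ j)] with z hz hzA
            gcongr
            exact hz hzA.1
        _ ≤ ∫⁻ z in ball 0 (2 * 2 ^ j), Ψ (2 ^ j) * u (y + c • z) ∂μ :=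
            lintegral_mono_set fun z hz => by simpa using hz.2
        _ = Ψ (2 ^ j) * ∫⁻ z in ball 0 (2 * 2 ^ j), u (y + c • z) ∂μ :=
            lintegral_const_mul _ (hu.comp (by fun_prop))
        _ ≤ Ψ (2 ^ j) * (μ (ball 0 (2 * 2 ^ j)) * maximalFn μ u y) := by
            gcongr
            exact setLIntegral_ball_comp_le μ u y hc (by positivity)
        _ = 4 ^ finrank ℝ E * (Ψ (2 ^ j) * μ (ball (0 : E) (2 ^ (j - 1)))) * maximalFn μ u y := by
            have : (2 : ℝ) * 2 ^ j = 4 * 2 ^ (j - 1) := by rw [hjj]; ring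
            rw [this, Measure.addHaar_ball_mul_of_pos μ _ (by norm_num : (0 : ℝ) < 4),
              ENNReal.ofReal_pow (by norm_num)]
            norm_num
            ring
        _ ≤ 4 ^ finrank ℝ E * (∫⁻ x in A (j - 1), Ψ ‖x‖ ∂μ) * maximalFn μ u y := by
            gcongr
            calc Ψ (2 ^ j) * μ (ball (0 : E) (2 ^ (j - 1))) ≤ Ψ (2 ^ j) * μ (A (j - 1)) := by
                  exact mul_le_mul_right (measure_ball_le_annulus μ hj1) _
              _ = ∫⁻ x in A (j - 1), Ψ (2 ^ j) ∂μ := (setLIntegral_const _ _).symm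
              _ ≤ _ := by
                  refine setLIntegral_mono' (hA _) fun x hx => hΨ ?_
                  rw [hjj]
                  exact hx.2.le
    calc kernelOp μ k c u y = ∫⁻ z in ⋃ j, A j, k z * u (y + c • z) ∂μ := by
          rw [Measure.restrict_eq_self_of_ae_mem hcover]; rfl
      _ = ∑' j, ∫⁻ z in A j, k z * u (y + c • z) ∂μ := lintegral_iUnion hA hAdisj _
      _ ≤ ∑' j : ℤ, 4 ^ finrank ℝ E * (∫⁻ x in A (j - 1), Ψ ‖x‖ ∂μ) * maximalFn μ u y :=
          ENNReal.tsum_le_tsum hstep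
      _ = 4 ^ finrank ℝ E * (∑' j : ℤ, ∫⁻ x in A (j - 1), Ψ ‖x‖ ∂μ) * maximalFn μ u y := by
          rw [ENNReal.tsum_mul_right, ENNReal.tsum_mul_left]
      _ = 4 ^ finrank ℝ E * (∑' j : ℤ, ∫⁻ x in A j, Ψ ‖x‖ ∂μ) * maximalFn μ u y := by
          rw [← (Equiv.subRight (1 : ℤ)).tsum_eq fun j => ∫⁻ x in A j, Ψ ‖x‖ ∂μ]
          rfl
      _ = 4 ^ finrank ℝ E * majorantIntegral μ k * maximalFn μ u y := by
          rw [← lintegral_iUnion hA hAdisj, Measure.restrict_eq_self_of_ae_mem hcover]; rfl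

/-- The maximal bound tested on `u = 1`. -/
theorem lintegral_le_majorantIntegral (k : E → ℝ≥0∞) :
    ∫⁻ z, k z ∂μ ≤ 4 ^ finrank ℝ E * majorantIntegral μ k := by
  have h := kernelOp_le_maximalFn μ k one_ne_zero (measurable_const (a := 1)) 0
  simp only [kernelOp, mul_one] at h
  exact h.trans (mul_le_of_le_one_right' (maximalFn_one_le μ 0))

variable {k u h : E → ℝ≥0∞}

theorem measurable_kernelOp (hk : Measurable k) (hu : Measurable u) (c : ℝ) :
    Measurable (kernelOp μ k c u) := by
  have : Measurable fun z : E × E => k z.2 * u (z.1 + c • z.2) :=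
    (hk.comp measurable_snd).mul (hu.comp (by fun_prop))
  exact this.lintegral_prod_right'

/-- The adjoint of convolution with a kernel. -/
theorem lintegral_kernelOp_mul (hk : Measurable k) (hu : Measurable u) (hh : Measurable h)
    (c : ℝ) :
    ∫⁻ y, kernelOp μ k c u y * h y ∂μ = ∫⁻ y, u y * kernelOp μ k (-c) h y ∂μ := by
  calc ∫⁻ y, kernelOp μ k c u y * h y ∂μ = ∫⁻ y, ∫⁻ z, k z * u (y + c • z) * h y ∂μ ∂μ := by
        refine lintegral_congr fun y => ?_
        have hm : Measurable fun z => k z * u (y + c • z) := hk.mul (hu.comp (by fun_prop))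
        rw [lintegral_mul_const _ hm]; rfl
    _ = ∫⁻ z, ∫⁻ y, k z * u (y + c • z) * h y ∂μ ∂μ := by
        refine lintegral_lintegral_swap (Measurable.aemeasurable ?_)
        exact ((hk.comp measurable_snd).mul (hu.comp (by fun_prop))).mul (hh.comp measurable_fst)
    _ = ∫⁻ z, ∫⁻ y, k z * u y * h (y + (-c) • z) ∂μ ∂μ := by
        refine lintegral_congr fun z => ?_
        -- For fixed `z`, translation by `c • z` moves the shift from `u` to `h`.
        rw [← lintegral_add_right_eq_self (fun y => k z * u y * h (y + (-c) • z)) (c • z)]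
        simp
    _ = ∫⁻ y, ∫⁻ z, k z * u y * h (y + (-c) • z) ∂μ ∂μ := by
        refine lintegral_lintegral_swap (Measurable.aemeasurable ?_)
        exact ((hk.comp measurable_fst).mul (hu.comp measurable_snd)).mul (hh.comp (by fun_prop))
    _ = _ := by
        refine lintegral_congr fun y => ?_
        have hm : Measurable fun z => k z * h (y + (-c) • z) := hk.mul (hh.comp (by fun_prop))
        rw [kernelOp, ← lintegral_const_mul _ hm]
        refine lintegral_congr fun z => ?_
        ring

/-- Cauchy–Schwarz for the measure `k dμ`, with `k` split into two square roots. -/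
theorem kernelOp_sq_le (hk : Measurable k) (hu : Measurable u) (c : ℝ) (y : E) :
    kernelOp μ k c u y ^ 2 ≤ (∫⁻ z, k z ∂μ) * kernelOp μ k c (fun x => u x ^ 2) y := by
  have hhalf : ∀ a : ℝ≥0∞, a ^ (1 / 2 : ℝ) * a ^ (1 / 2 : ℝ) = a := by
    intro a
    rw [← ENNReal.rpow_add_of_nonneg _ _ (by norm_num) (by norm_num)]
    norm_num
  have hsq : ∀ a : ℝ≥0∞, (a ^ (1 / 2 : ℝ)) ^ (2 : ℝ) = a := by
    intro a
    rw [← ENNReal.rpow_mul]; norm_num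
  have hm : Measurable fun z => u (y + c • z) := hu.comp (by fun_prop)
  have h := ENNReal.lintegral_mul_le_Lp_mul_Lq μ Real.HolderConjugate.two_two
    (f := fun z => k z ^ (1 / 2 : ℝ)) (g := fun z => k z ^ (1 / 2 : ℝ) * u (y + c • z))
    (hk.pow_const _).aemeasurable ((hk.pow_const _).mul hm).aemeasurable
  simp only [Pi.mul_apply, ← mul_assoc, hhalf, ENNReal.mul_rpow_of_nonneg _ _ zero_le_two, hsq] at h
  calc kernelOp μ k c u y ^ 2 ≤ _ := pow_le_pow_left' h 2
    _ = _ := by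
      rw [mul_pow, ← ENNReal.rpow_natCast, ← ENNReal.rpow_natCast, ← ENNReal.rpow_mul,
        ← ENNReal.rpow_mul]
      simp [kernelOp]

end Kernel

/-! ### Square function estimates -/

/-- The absorption step that closes each duality argument below: divide by `a ^ (1 / q)`, which is
legitimate because `a` is finite. -/
theorem le_rpow_of_le_mul_rpow {a b : ℝ≥0∞} {p q : ℝ} (hpq : p.HolderConjugate q) (ha : a ≠ ∞)
    (h : a ≤ b * a ^ (1 / q)) : a ≤ b ^ p := by
  rcases eq_or_ne a 0 with rfl | h0
  · exact zero_le
  have h1 : a ^ (1 / q) ≠ 0 := by simp [h0, ha]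
  have h2 : a ^ (1 / q) ≠ ∞ := ENNReal.rpow_ne_top_of_nonneg hpq.symm.one_div_nonneg ha
  have h3 : a ^ (1 / p) * a ^ (1 / q) = a := by
    rw [← ENNReal.rpow_add _ _ h0 ha, one_div, one_div, hpq.inv_add_inv_eq_one, ENNReal.rpow_one]
  have h4 : a ^ (1 / p) ≤ b := by
    refine (ENNReal.mul_le_mul_iff_left h1 h2).1 ?_
    rwa [h3]
  calc a = (a ^ (1 / p)) ^ p := by
        rw [← ENNReal.rpow_mul, one_div_mul_cancel hpq.ne_zero, ENNReal.rpow_one]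
    _ ≤ b ^ p := ENNReal.rpow_le_rpow h4 hpq.nonneg

/-- Bounds the sum by its cardinality times its largest term. The loss in the cardinality is
harmless, since only finiteness is drawn from it. -/
theorem sum_rpow_le {ι : Type*} (s : Finset ι) (a : ι → ℝ≥0∞) {r : ℝ} (hr : 0 < r) :
    (∑ i ∈ s, a i) ^ r ≤ ∑ i ∈ s, (s.card : ℝ≥0∞) ^ r * a i ^ r := by
  rcases s.eq_empty_or_nonempty with rfl | hs
  · simp [hr]
  obtain ⟨i, hi, hmax⟩ := s.exists_max_image a hs
  calc (∑ i ∈ s, a i) ^ r ≤ (s.card * a i) ^ r := by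
        gcongr
        simpa using s.sum_le_card_nsmul a (a i) hmax
    _ = (s.card : ℝ≥0∞) ^ r * a i ^ r := ENNReal.mul_rpow_of_nonneg _ _ hr.le
    _ ≤ _ := Finset.single_le_sum (f := fun i => (s.card : ℝ≥0∞) ^ r * a i ^ r)
        (fun _ _ => zero_le) hi

section Square

variable {E : Type*} [NormedAddCommGroup E] [NormedSpace ℝ E] [MeasurableSpace E] [BorelSpace E]
  [FiniteDimensional ℝ E] (μ : Measure E) [μ.IsAddHaarMeasure]

theorem exists_lintegral_kernelOp_rpow_le {q : ℝ} (hq : 1 < q) {N : ℝ≥0∞} (hN : N ≠ ∞) :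
    ∃ C : ℝ≥0∞, C ≠ ∞ ∧ ∀ (k : E → ℝ≥0∞) (c : ℝ) (u : E → ℝ≥0∞),
      majorantIntegral μ k ≤ N → c ≠ 0 → Measurable u →
      ∫⁻ y, kernelOp μ k c u y ^ q ∂μ ≤ C * ∫⁻ y, u y ^ q ∂μ := by
  obtain ⟨C, hC, hmax⟩ := exists_lintegral_maximalFn_rpow_le μ hq
  have hq0 : 0 ≤ q := by linarith
  refine ⟨(4 ^ finrank ℝ E * N) ^ q * C, by finiteness, fun k c u hk hc hu => ?_⟩
  calc ∫⁻ y, kernelOp μ k c u y ^ q ∂μ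
      ≤ ∫⁻ y, (4 ^ finrank ℝ E * N) ^ q * maximalFn μ u y ^ q ∂μ := by
        refine lintegral_mono fun y => ?_
        rw [← ENNReal.mul_rpow_of_nonneg _ _ hq0]
        gcongr
        exact (kernelOp_le_maximalFn μ k hc hu y).trans (by gcongr)
    _ = (4 ^ finrank ℝ E * N) ^ q * ∫⁻ y, maximalFn μ u y ^ q ∂μ :=
        lintegral_const_mul _ ((measurable_maximalFn μ u).pow_const q)
    _ ≤ _ := by
        rw [mul_assoc]
        gcongr
        exact hmax u hu

/-- Supplies the finiteness required by the absorption step; the scalar bound is applied to each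
term separately. -/
theorem lintegral_square_kernelOp_ne_top {q : ℝ} (hq : 1 < q) {N : ℝ≥0∞} (hN : N ≠ ∞) {n : ℕ}
    {k u : Fin n → E → ℝ≥0∞} {c : ℝ} (hc : c ≠ 0) (hk : ∀ i, Measurable (k i))
    (hu : ∀ i, Measurable (u i)) (hkN : ∀ i, majorantIntegral μ (k i) ≤ N)
    (h : ∫⁻ y, (∑ i, u i y ^ 2) ^ (q / 2) ∂μ ≠ ∞) :
    ∫⁻ y, (∑ i, kernelOp μ (k i) c (u i) y ^ 2) ^ (q / 2) ∂μ ≠ ∞ := by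
  obtain ⟨C, hC, hb⟩ := exists_lintegral_kernelOp_rpow_le μ hq hN
  have hq0 : 0 < q / 2 := by linarith
  have hpow : ∀ a : ℝ≥0∞, (a ^ 2) ^ (q / 2) = a ^ q := by
    intro a
    rw [← ENNReal.rpow_natCast, ← ENNReal.rpow_mul]
    congr 1; push_cast; ring
  refine ne_top_of_le_ne_top ?_ (lintegral_mono fun y => sum_rpow_le Finset.univ
    (fun i => kernelOp μ (k i) c (u i) y ^ 2) hq0)
  rw [lintegral_finsetSum _ fun i _ =>
    (((measurable_kernelOp μ (hk i) (hu i) c).pow_const 2).pow_const (q / 2)).const_mul _]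
  refine ENNReal.sum_ne_top.2 fun i _ => ?_
  rw [lintegral_const_mul _
    (((measurable_kernelOp μ (hk i) (hu i) c).pow_const 2).pow_const (q / 2))]
  simp only [hpow]
  have h1 : ∫⁻ y, u i y ^ q ∂μ ≠ ∞ := by
    refine ne_top_of_le_ne_top h (lintegral_mono fun y => ?_)
    rw [← hpow]
    gcongr
    exact Finset.single_le_sum (f := fun i => u i y ^ 2) (fun _ _ => zero_le) (Finset.mem_univ i)
  have h2 := hb (k i) c (u i) (hkN i) hc (hu i)
  have h3 : ∫⁻ y, kernelOp μ (k i) c (u i) y ^ q ∂μ ≠ ∞ := ne_top_of_le_ne_top (by finiteness) h2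
  finiteness

/-- Testing the square function against a weight. -/
theorem lintegral_square_kernelOp_mul_le {N : ℝ≥0∞} {n : ℕ}
    {k u : Fin n → E → ℝ≥0∞} {h : E → ℝ≥0∞} {c : ℝ} (hc : c ≠ 0) (hk : ∀ i, Measurable (k i))
    (hu : ∀ i, Measurable (u i)) (hh : Measurable h)
    (hkN : ∀ i, majorantIntegral μ (k i) ≤ N) :
    ∫⁻ y, (∑ i, kernelOp μ (k i) c (u i) y ^ 2) * h y ∂μ ≤
      (4 ^ finrank ℝ E * N) ^ 2 * ∫⁻ y, (∑ i, u i y ^ 2) * maximalFn μ h y ∂μ := by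
  set K := 4 ^ finrank ℝ E * N
  have hu2 : ∀ i, Measurable fun y => u i y ^ 2 := fun i => (hu i).pow_const 2
  have hS : ∀ i, Measurable (kernelOp μ (k i) c fun y => u i y ^ 2) := fun i =>
    measurable_kernelOp μ (hk i) (hu2 i) c
  have hM := measurable_maximalFn μ h
  calc ∫⁻ y, (∑ i, kernelOp μ (k i) c (u i) y ^ 2) * h y ∂μ
      ≤ ∫⁻ y, ∑ i, K * (kernelOp μ (k i) c (fun y => u i y ^ 2) y * h y) ∂μ := by
        refine lintegral_mono fun y => ?_
        rw [Finset.sum_mul]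
        refine Finset.sum_le_sum fun i _ => ?_
        rw [← mul_assoc]
        gcongr
        refine (kernelOp_sq_le μ (hk i) (hu i) c y).trans ?_
        gcongr
        exact (lintegral_le_majorantIntegral μ (k i)).trans (mul_le_mul' le_rfl (hkN i))
    _ = ∑ i, K * ∫⁻ y, kernelOp μ (k i) c (fun y => u i y ^ 2) y * h y ∂μ := by
        rw [lintegral_finsetSum _ fun i _ => ((hS i).fun_mul hh).const_mul K]
        exact Finset.sum_congr rfl fun i _ => lintegral_const_mul _ ((hS i).mul hh)
    _ = ∑ i, K * ∫⁻ y, u i y ^ 2 * kernelOp μ (k i) (-c) h y ∂μ := by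
        refine Finset.sum_congr rfl fun i _ => ?_
        rw [lintegral_kernelOp_mul μ (hk i) (hu2 i) hh]
    -- The first `K` bounds the mass of the kernel in Cauchy–Schwarz, the second comes from
    -- dominating the adjoint by the maximal function. The latter no longer depends on `i`, which
    -- lets the sum re-form.
    _ ≤ ∑ i, K * ∫⁻ y, u i y ^ 2 * (K * maximalFn μ h y) ∂μ := by
        gcongr with i _ y
        exact (kernelOp_le_maximalFn μ (k i) (neg_ne_zero.2 hc) hh y).trans
          (mul_le_mul' (mul_le_mul' le_rfl (hkN i)) le_rfl)
    _ = _ := by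
        simp_rw [Finset.sum_mul]
        rw [lintegral_finsetSum _ fun i _ => (hu2 i).fun_mul hM, Finset.mul_sum]
        refine Finset.sum_congr rfl fun i _ => ?_
        rw [sq, mul_assoc K K, ← lintegral_const_mul _ ((hu2 i).fun_mul hM)]
        congr 1
        refine lintegral_congr fun y => ?_
        ring

/-- Duality in `L^r` with `r = q / 2`: the weight `F ^ (r - 1)` is extremal for `F` in `L^r`, and
the maximal function is bounded on the dual space. At `q = 2` the dual exponent is infinite and the
weight `1` suffices. -/
theorem exists_lintegral_square_kernelOp_le_of_two_le {q : ℝ} (hq : 2 ≤ q) {N : ℝ≥0∞}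
    (hN : N ≠ ∞) :
    ∃ C : ℝ≥0∞, C ≠ ∞ ∧ ∀ (n : ℕ) (k u : Fin n → E → ℝ≥0∞) (c : ℝ), c ≠ 0 →
      (∀ i, Measurable (k i)) → (∀ i, Measurable (u i)) →
      (∀ i, majorantIntegral μ (k i) ≤ N) →
      ∫⁻ y, (∑ i, u i y ^ 2) ^ (q / 2) ∂μ ≠ ∞ →
      ∫⁻ y, (∑ i, kernelOp μ (k i) c (u i) y ^ 2) ^ (q / 2) ∂μ ≤
        C * ∫⁻ y, (∑ i, u i y ^ 2) ^ (q / 2) ∂μ := by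
  rcases hq.eq_or_lt with rfl | hq
  · refine ⟨(4 ^ finrank ℝ E * N) ^ 2, by finiteness, fun n k u c hc hk hu hkN _ => ?_⟩
    have h := lintegral_square_kernelOp_mul_le μ hc hk hu (measurable_const (a := 1)) hkN
    simp only [mul_one] at h
    simp only [div_self (two_ne_zero' ℝ), ENNReal.rpow_one]
    refine h.trans ?_
    gcongr with y
    exact mul_le_of_le_one_right' (maximalFn_one_le μ y)
  set r := q / 2 with hr
  have hr1 : 1 < r := by rw [hr]; linarith
  have hconj := Real.HolderConjugate.conjExponent hr1
  set s := r.conjExponent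
  obtain ⟨C, hC, hmax⟩ := exists_lintegral_maximalFn_rpow_le μ hconj.symm.lt
  set K := (4 ^ finrank ℝ E * N) ^ 2
  have hs0 : 0 ≤ 1 / s := hconj.symm.one_div_nonneg
  have hr0 : 0 ≤ r := by linarith
  refine ⟨(K * C ^ (1 / s)) ^ r, by finiteness, fun n k u c hc hk hu hkN hfin => ?_⟩
  have hX := lintegral_square_kernelOp_ne_top μ (by linarith : 1 < q) hN hc hk hu hkN hfin
  set F : E → ℝ≥0∞ := fun y => ∑ i, kernelOp μ (k i) c (u i) y ^ 2
  set V : E → ℝ≥0∞ := fun y => ∑ i, u i y ^ 2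
  have hF : Measurable F := Finset.measurable_fun_sum _ fun i _ =>
    (measurable_kernelOp μ (hk i) (hu i) c).pow_const 2
  have hV : Measurable V := Finset.measurable_fun_sum _ fun i _ => (hu i).pow_const 2
  have hFr : ∀ y, F y ^ r = F y * F y ^ (r - 1) := fun y => by
    conv_lhs => rw [show r = 1 + (r - 1) by ring,
      ENNReal.rpow_add_of_nonneg _ _ zero_le_one (by linarith), ENNReal.rpow_one]
  have key : ∫⁻ y, F y ^ r ∂μ ≤
      K * C ^ (1 / s) * (∫⁻ y, V y ^ r ∂μ) ^ (1 / r) * (∫⁻ y, F y ^ r ∂μ) ^ (1 / s) := by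
    calc ∫⁻ y, F y ^ r ∂μ = ∫⁻ y, F y * F y ^ (r - 1) ∂μ := lintegral_congr hFr
      _ ≤ K * ∫⁻ y, V y * maximalFn μ (fun y => F y ^ (r - 1)) y ∂μ :=
          lintegral_square_kernelOp_mul_le μ hc hk hu (hF.pow_const _) hkN
      _ ≤ K * ((∫⁻ y, V y ^ r ∂μ) ^ (1 / r) *
            (∫⁻ y, maximalFn μ (fun y => F y ^ (r - 1)) y ^ s ∂μ) ^ (1 / s)) := by
          gcongr
          exact ENNReal.lintegral_mul_le_Lp_mul_Lq μ hconj hV.aemeasurable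
            (measurable_maximalFn μ _).aemeasurable
      _ ≤ K * ((∫⁻ y, V y ^ r ∂μ) ^ (1 / r) *
            (C * ∫⁻ y, (F y ^ (r - 1)) ^ s ∂μ) ^ (1 / s)) := by
          gcongr
          exact hmax _ (hF.pow_const _)
      _ = _ := by
          rw [ENNReal.mul_rpow_of_nonneg _ _ hs0]
          simp_rw [← ENNReal.rpow_mul, hconj.sub_one_mul_conj]
          ring
  refine (le_rpow_of_le_mul_rpow hconj hX key).trans_eq ?_
  rw [ENNReal.mul_rpow_of_nonneg _ _ hr0, ← ENNReal.rpow_mul _ (1 / r),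
    one_div_mul_cancel hconj.ne_zero, ENNReal.rpow_one]

/-- **Vector-valued estimate** for positive convolutions with radially dominated kernels. -/
theorem exists_lintegral_square_kernelOp_le {q : ℝ} (hq : 1 < q) {N : ℝ≥0∞} (hN : N ≠ ∞) :
    ∃ C : ℝ≥0∞, C ≠ ∞ ∧ ∀ (n : ℕ) (k u : Fin n → E → ℝ≥0∞) (c : ℝ), c ≠ 0 →
      (∀ i, Measurable (k i)) → (∀ i, Measurable (u i)) →
      (∀ i, majorantIntegral μ (k i) ≤ N) →
      ∫⁻ y, (∑ i, u i y ^ 2) ^ (q / 2) ∂μ ≠ ∞ →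
      ∫⁻ y, (∑ i, kernelOp μ (k i) c (u i) y ^ 2) ^ (q / 2) ∂μ ≤
        C * ∫⁻ y, (∑ i, u i y ^ 2) ^ (q / 2) ∂μ := by
  rcases le_or_gt 2 q with h2 | h2
  · exact exists_lintegral_square_kernelOp_le_of_two_le μ h2 hN
  have hconj := Real.HolderConjugate.conjExponent hq
  set s := q.conjExponent
  have hs2 : 2 ≤ s := by
    have : s = q / (q - 1) := rfl
    rw [this, le_div_iff₀ (by linarith)]; linarith
  have hs0 : 0 ≤ 1 / s := hconj.symm.one_div_nonneg
  have hq0 : 0 < q := by linarith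
  obtain ⟨C, hC, hsq⟩ := exists_lintegral_square_kernelOp_le_of_two_le μ hs2 hN
  refine ⟨(C ^ (1 / s)) ^ q, by finiteness, fun n k u c hc hk hu hkN hfin => ?_⟩
  have hX := lintegral_square_kernelOp_ne_top μ hq hN hc hk hu hkN hfin
  set F : E → ℝ≥0∞ := fun y => ∑ i, kernelOp μ (k i) c (u i) y ^ 2 with hFdef
  set V : E → ℝ≥0∞ := fun y => ∑ i, u i y ^ 2
  have hSm : ∀ i, Measurable (kernelOp μ (k i) c (u i)) := fun i =>
    measurable_kernelOp μ (hk i) (hu i) c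
  have hF : Measurable F := Finset.measurable_fun_sum _ fun i _ => (hSm i).pow_const 2
  have hV : Measurable V := Finset.measurable_fun_sum _ fun i _ => (hu i).pow_const 2
  -- The extremal dual family: its pairing with the `kernelOp μ (k i) c (u i)` is `F ^ (q / 2)`, and
  -- its `L^s(ℓ²)` norm to the power `s` is again the integral of `F ^ (q / 2)`.
  set v : Fin n → E → ℝ≥0∞ := fun i y => kernelOp μ (k i) c (u i) y * F y ^ (q / 2 - 1)
  have hv : ∀ i, Measurable (v i) := fun i => (hSm i).mul (hF.pow_const _)
  set W : E → ℝ≥0∞ := fun y => ∑ i, kernelOp μ (k i) (-c) (v i) y ^ 2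
  have hTm : ∀ i, Measurable (kernelOp μ (k i) (-c) (v i)) := fun i =>
    measurable_kernelOp μ (hk i) (hv i) _
  have hW : Measurable W := Finset.measurable_fun_sum _ fun i _ => (hTm i).pow_const 2
  have hFfin : ∀ᵐ y ∂μ, F y ≠ ∞ := by
    filter_upwards [ae_lt_top (hF.pow_const (q / 2)) hX] with y hy h
    rw [h, ENNReal.top_rpow_of_pos (by linarith)] at hy
    exact hy.ne rfl
  -- For `t < 1` this fails at `F y = ∞`, where the left side is `∞ * 0 = 0`; hence the almost
  -- everywhere finiteness above.
  have hFpow : ∀ y, F y ≠ ∞ → ∀ t : ℝ, 0 < t → F y * F y ^ (t - 1) = F y ^ t := by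
    intro y hy t ht
    rcases eq_or_ne (F y) 0 with h0 | h0
    · simp [h0, ht]
    · conv_lhs => rw [← ENNReal.rpow_one (F y), ← ENNReal.rpow_mul, ← ENNReal.rpow_add _ _ h0 hy]
      congr 1; ring
  have hvsum : ∀ y, F y ≠ ∞ → ∑ i, v i y ^ 2 = F y ^ (q - 1) := by
    intro y hy
    simp only [v, mul_pow]
    rw [← Finset.sum_mul, ← hFpow y hy (q - 1) (by linarith)]
    congr 1
    rw [← ENNReal.rpow_natCast, ← ENNReal.rpow_mul]
    congr 1; push_cast; ring
  have hvint : ∫⁻ y, (∑ i, v i y ^ 2) ^ (s / 2) ∂μ = ∫⁻ y, F y ^ (q / 2) ∂μ := by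
    refine lintegral_congr_ae ?_
    filter_upwards [hFfin] with y hy
    rw [hvsum y hy, ← ENNReal.rpow_mul, ← mul_div_assoc, hconj.sub_one_mul_conj]
  have key : ∫⁻ y, F y ^ (q / 2) ∂μ ≤
      C ^ (1 / s) * (∫⁻ y, V y ^ (q / 2) ∂μ) ^ (1 / q) *
        (∫⁻ y, F y ^ (q / 2) ∂μ) ^ (1 / s) := by
    calc ∫⁻ y, F y ^ (q / 2) ∂μ = ∫⁻ y, ∑ i, kernelOp μ (k i) c (u i) y * v i y ∂μ := by
          refine lintegral_congr_ae ?_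
          filter_upwards [hFfin] with y hy
          rw [← hFpow y hy _ (by linarith)]
          conv_lhs => rw [hFdef]
          rw [Finset.sum_mul]
          refine Finset.sum_congr rfl fun i _ => ?_
          simp only [v]; ring
      _ = ∫⁻ y, ∑ i, u i y * kernelOp μ (k i) (-c) (v i) y ∂μ := by
          rw [lintegral_finsetSum _ fun i _ => (hSm i).fun_mul (hv i),
            lintegral_finsetSum _ fun i _ => (hu i).fun_mul (hTm i)]
          exact Finset.sum_congr rfl fun i _ => lintegral_kernelOp_mul μ (hk i) (hu i) (hv i) c
      _ ≤ ∫⁻ y, V y ^ (1 / 2 : ℝ) * W y ^ (1 / 2 : ℝ) ∂μ := by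
          refine lintegral_mono fun y => ?_
          have := ENNReal.inner_le_Lp_mul_Lq Finset.univ (fun i => u i y)
            (fun i => kernelOp μ (k i) (-c) (v i) y) Real.HolderConjugate.two_two
          simpa [V, W] using this
      _ ≤ (∫⁻ y, (V y ^ (1 / 2 : ℝ)) ^ q ∂μ) ^ (1 / q) *
            (∫⁻ y, (W y ^ (1 / 2 : ℝ)) ^ s ∂μ) ^ (1 / s) :=
          ENNReal.lintegral_mul_le_Lp_mul_Lq μ hconj (hV.pow_const _).aemeasurable
            (hW.pow_const _).aemeasurable
      _ = (∫⁻ y, V y ^ (q / 2) ∂μ) ^ (1 / q) * (∫⁻ y, W y ^ (s / 2) ∂μ) ^ (1 / s) := by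
          simp_rw [← ENNReal.rpow_mul, one_div_mul_eq_div]
      _ ≤ (∫⁻ y, V y ^ (q / 2) ∂μ) ^ (1 / q) *
            (C * ∫⁻ y, (∑ i, v i y ^ 2) ^ (s / 2) ∂μ) ^ (1 / s) := by
          gcongr
          exact hsq n k v (-c) (neg_ne_zero.2 hc) hk hv hkN (by rwa [hvint])
      _ = _ := by
          rw [hvint, ENNReal.mul_rpow_of_nonneg _ _ hs0]
          ring
  refine (le_rpow_of_le_mul_rpow hconj hX key).trans_eq ?_
  rw [ENNReal.mul_rpow_of_nonneg _ _ hq0.le, ← ENNReal.rpow_mul _ (1 / q),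
    one_div_mul_cancel hconj.ne_zero, ENNReal.rpow_one]

end Square

/-! ### Khintchine's inequality -/

/-- The signed sum `∑ᵢ rᵢ zᵢ`. -/
def signSum {X : Type*} [NormedAddCommGroup X] [NormedSpace ℂ X] {n : ℕ} (z : Fin n → X)
    (r : Fin n → ℤˣ) : X :=
  ∑ i, (((r i : ℤ) : ℂ)) • z i

theorem sum_exp_sign {n : ℕ} (a : Fin n → ℝ) :
    ∑ r : Fin n → ℤˣ, Real.exp (∑ i, ((r i : ℤ) : ℝ) * a i) = ∏ i, (2 * Real.cosh (a i)) := by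
  have h : ∀ i, 2 * Real.cosh (a i) = ∑ s : ℤˣ, Real.exp (((s : ℤ) : ℝ) * a i) := by
    intro i
    rw [UnitsInt.univ, Finset.sum_pair (by decide), Real.cosh_eq]
    simp; ring
  simp_rw [h, Real.exp_sum]
  rw [Finset.prod_univ_sum, Fintype.piFinset_univ]

/-- Sign sums are subgaussian: independence gives a product of hyperbolic cosines, and `cosh x ≤ exp
(x² / 2)`. -/
theorem sum_exp_sign_le {n : ℕ} (a : Fin n → ℝ) (ha : ∑ i, a i ^ 2 ≤ 1) :
    (1 / 2 ^ n) * ∑ r : Fin n → ℤˣ, Real.exp (∑ i, ((r i : ℤ) : ℝ) * a i) ≤ Real.exp 1 := by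
  rw [sum_exp_sign, Finset.prod_mul_distrib]
  simp only [Finset.prod_const, Finset.card_univ, Fintype.card_fin]
  rw [← mul_assoc, one_div, inv_mul_cancel₀ (by positivity), one_mul]
  calc ∏ i, Real.cosh (a i) ≤ ∏ i, Real.exp (a i ^ 2 / 2) :=
        Finset.prod_le_prod (fun i _ => (Real.cosh_pos _).le) fun i _ => Real.cosh_le_exp_half_sq _
    _ = Real.exp ((∑ i, a i ^ 2) / 2) := by rw [← Real.exp_sum, Finset.sum_div]
    _ ≤ Real.exp 1 := by
        apply Real.exp_le_exp.2
        linarith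

theorem exists_rpow_le_exp (q : ℝ) (hq : 0 < q) : ∃ C : ℝ, 0 < C ∧ ∀ x : ℝ,
    |x| ^ q ≤ C * (Real.exp x + Real.exp (-x)) := by
  set m := ⌈q⌉₊
  refine ⟨1 + m.factorial, by positivity, fun x => ?_⟩
  have h1 : |x| ^ q ≤ 1 + |x| ^ m := by
    rcases le_total |x| 1 with h | h
    · have := Real.rpow_le_one (abs_nonneg x) h hq.le
      have : 0 ≤ |x| ^ m := by positivity
      linarith
    · have : |x| ^ q ≤ |x| ^ (m : ℝ) := Real.rpow_le_rpow_of_exponent_le h (Nat.le_ceil q)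
      rw [Real.rpow_natCast] at this
      linarith
  have h2 : |x| ^ m ≤ m.factorial * Real.exp |x| := by
    have := Real.pow_div_factorial_le_exp |x| (abs_nonneg x) m
    rw [div_le_iff₀ (by positivity)] at this
    linarith
  have h3 : 1 ≤ Real.exp |x| := Real.one_le_exp (abs_nonneg x)
  have h4 : Real.exp |x| ≤ Real.exp x + Real.exp (-x) := by
    rcases abs_choice x with h | h <;> rw [h] <;> linarith [Real.exp_pos x, Real.exp_pos (-x)]
  calc |x| ^ q ≤ (1 + m.factorial) * Real.exp |x| := by linarith
    _ ≤ _ := by gcongr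

/-- After scaling to `∑ a i ^ 2 = 1`, the `q`-th moment is dominated by the exponential moments of
the sum and of its negative. -/
theorem exists_khintchine_real (q : ℝ) (hq : 0 < q) : ∃ C : ℝ, 0 < C ∧
    ∀ (n : ℕ) (a : Fin n → ℝ),
      (1 / 2 ^ n) * ∑ r : Fin n → ℤˣ, |∑ i, ((r i : ℤ) : ℝ) * a i| ^ q ≤
        C * (∑ i, a i ^ 2) ^ (q / 2) := by
  obtain ⟨C, hC, hexp⟩ := exists_rpow_le_exp q hq
  refine ⟨C * (2 * Real.exp 1), by positivity, fun n a => ?_⟩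
  set S := ∑ i, a i ^ 2 with hS
  have hS0 : 0 ≤ S := Finset.sum_nonneg fun i _ => sq_nonneg _
  rcases hS0.eq_or_lt with h0 | h0
  · have ha : ∀ i, a i = 0 := by
      intro i
      have := (Finset.sum_eq_zero_iff_of_nonneg fun i _ => sq_nonneg (a i)).1 h0.symm i
        (Finset.mem_univ i)
      simpa using this
    simp only [ha, mul_zero, Finset.sum_const_zero, abs_zero, Real.zero_rpow hq.ne']
    positivity
  · set σ := Real.sqrt S
    have hσ : 0 < σ := Real.sqrt_pos.2 h0
    have hσ2 : σ ^ 2 = S := Real.sq_sqrt hS0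
    have hσq : σ ^ q = S ^ (q / 2) := by
      rw [← hσ2, ← Real.rpow_natCast, ← Real.rpow_mul hσ.le]; congr 1; push_cast; ring
    set b : Fin n → ℝ := fun i => a i / σ
    have hb : ∑ i, b i ^ 2 ≤ 1 := by
      simp only [b, div_pow, ← Finset.sum_div]
      rw [hσ2, ← hS, div_self h0.ne']
    have hb' : ∑ i, (-b i) ^ 2 ≤ 1 := by simpa using hb
    have hsum : ∀ r : Fin n → ℤˣ, |∑ i, ((r i : ℤ) : ℝ) * a i| ^ q =
        σ ^ q * |∑ i, ((r i : ℤ) : ℝ) * b i| ^ q := by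
      intro r
      rw [← Real.mul_rpow hσ.le (abs_nonneg _)]
      congr 1
      have : ∑ i, ((r i : ℤ) : ℝ) * a i = σ * ∑ i, ((r i : ℤ) : ℝ) * b i := by
        rw [Finset.mul_sum]
        refine Finset.sum_congr rfl fun i _ => ?_
        simp only [b]; field_simp
      rw [this, abs_mul, abs_of_pos hσ]
    have h1 := sum_exp_sign_le b hb
    have h2 := sum_exp_sign_le (fun i => -b i) hb'
    calc (1 / 2 ^ n) * ∑ r : Fin n → ℤˣ, |∑ i, ((r i : ℤ) : ℝ) * a i| ^ q
        = σ ^ q * ((1 / 2 ^ n) * ∑ r : Fin n → ℤˣ, |∑ i, ((r i : ℤ) : ℝ) * b i| ^ q) := by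
          simp_rw [hsum]; rw [← Finset.mul_sum]; ring
      _ ≤ σ ^ q * ((1 / 2 ^ n) * ∑ r : Fin n → ℤˣ,
            C * (Real.exp (∑ i, ((r i : ℤ) : ℝ) * b i) +
              Real.exp (∑ i, ((r i : ℤ) : ℝ) * -b i))) := by
          gcongr with r
          refine (hexp _).trans_eq ?_
          simp only [mul_neg, Finset.sum_neg_distrib]
      _ = σ ^ q * C * ((1 / 2 ^ n) * ∑ r : Fin n → ℤˣ, Real.exp (∑ i, ((r i : ℤ) : ℝ) * b i) +
            (1 / 2 ^ n) * ∑ r : Fin n → ℤˣ, Real.exp (∑ i, ((r i : ℤ) : ℝ) * -b i)) := by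
          rw [← Finset.mul_sum, Finset.sum_add_distrib]; ring
      _ ≤ σ ^ q * C * (Real.exp 1 + Real.exp 1) := by gcongr
      _ = _ := by rw [hσq]; ring

theorem exists_khintchine_complex (q : ℝ) (hq : 0 < q) : ∃ C : ℝ, 0 < C ∧
    ∀ (n : ℕ) (z : Fin n → ℂ),
      (1 / 2 ^ n) * ∑ r : Fin n → ℤˣ, ‖signSum z r‖ ^ q ≤ C * (∑ i, ‖z i‖ ^ 2) ^ (q / 2) := by
  obtain ⟨C, hC, hk⟩ := exists_khintchine_real q hq
  refine ⟨2 ^ q * (C + C), by positivity, fun n z => ?_⟩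
  have hre : ∀ r, (signSum z r).re = ∑ i, ((r i : ℤ) : ℝ) * (z i).re := by
    intro r; simp [signSum]
  have him : ∀ r, (signSum z r).im = ∑ i, ((r i : ℤ) : ℝ) * (z i).im := by
    intro r; simp [signSum]
  have hb : ∀ w : ℂ, ‖w‖ ^ q ≤ 2 ^ q * (|w.re| ^ q + |w.im| ^ q) := by
    intro w
    have h1 := Complex.norm_le_abs_re_add_abs_im w
    have key : ∀ s t : ℝ, 0 ≤ s → 0 ≤ t → s ≤ t → (s + t) ^ q ≤ 2 ^ q * t ^ q := by
      intro s t hs ht hst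
      rw [← Real.mul_rpow zero_le_two ht]
      gcongr; linarith
    have hp1 : 0 ≤ |w.re| ^ q := by positivity
    have hp2 : 0 ≤ |w.im| ^ q := by positivity
    have h2 : (0 : ℝ) < 2 ^ q := by positivity
    have h3 : ‖w‖ ^ q ≤ (|w.re| + |w.im|) ^ q := by gcongr
    rcases le_total |w.re| |w.im| with h | h
    · have := key _ _ (abs_nonneg _) (abs_nonneg _) h
      nlinarith
    · have := key _ _ (abs_nonneg _) (abs_nonneg _) h
      rw [add_comm] at this
      nlinarith
  have hS : ∀ f : Fin n → ℝ, (∀ i, |f i| ≤ ‖z i‖) →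
      (∑ i, f i ^ 2) ^ (q / 2) ≤ (∑ i, ‖z i‖ ^ 2) ^ (q / 2) := by
    intro f hf
    have : 0 ≤ ∑ i, f i ^ 2 := Finset.sum_nonneg fun i _ => sq_nonneg _
    gcongr ?_ ^ (q / 2)
    refine Finset.sum_le_sum fun i _ => ?_
    rw [← sq_abs]
    gcongr
    exact hf i
  calc (1 / 2 ^ n) * ∑ r : Fin n → ℤˣ, ‖signSum z r‖ ^ q
      ≤ (1 / 2 ^ n) * ∑ r : Fin n → ℤˣ,
          2 ^ q * (|(signSum z r).re| ^ q + |(signSum z r).im| ^ q) := by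
        gcongr with r; exact hb _
    _ = 2 ^ q * ((1 / 2 ^ n) * ∑ r : Fin n → ℤˣ, |∑ i, ((r i : ℤ) : ℝ) * (z i).re| ^ q +
          (1 / 2 ^ n) * ∑ r : Fin n → ℤˣ, |∑ i, ((r i : ℤ) : ℝ) * (z i).im| ^ q) := by
        simp_rw [hre, him]
        rw [← Finset.mul_sum, Finset.sum_add_distrib]; ring
    _ ≤ 2 ^ q * (C * (∑ i, (z i).re ^ 2) ^ (q / 2) + C * (∑ i, (z i).im ^ 2) ^ (q / 2)) := by
        gcongr 2 ^ q * (?_ + ?_)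
        · exact hk n _
        · exact hk n _
    _ ≤ 2 ^ q * (C * (∑ i, ‖z i‖ ^ 2) ^ (q / 2) + C * (∑ i, ‖z i‖ ^ 2) ^ (q / 2)) := by
        gcongr 2 ^ q * (C * ?_ + C * ?_)
        · exact hS _ fun i => Complex.abs_re_le_norm _
        · exact hS _ fun i => Complex.abs_im_le_norm _
    _ = _ := by ring

/-- Induction on `n`: summing over the first sign is the parallelogram law. -/
theorem sum_norm_signSum_sq {n : ℕ} (z : Fin n → ℂ) :
    ∑ r : Fin n → ℤˣ, ‖signSum z r‖ ^ 2 = 2 ^ n * ∑ i, ‖z i‖ ^ 2 := by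
  induction n with
  | zero => simp [signSum]
  | succ n ih =>
    rw [← (Fin.consEquiv fun _ => ℤˣ).sum_comp, Fintype.sum_prod_type_right]
    have h : ∀ r : Fin n → ℤˣ,
        ∑ s : ℤˣ, ‖signSum z (Fin.consEquiv (fun _ => ℤˣ) (s, r))‖ ^ 2 =
          2 * (‖z 0‖ ^ 2 + ‖signSum (fun i => z i.succ) r‖ ^ 2) := by
      intro r
      have hs : ∀ s : ℤˣ, signSum z (Fin.consEquiv (fun _ => ℤˣ) (s, r)) =
          ((s : ℤ) : ℂ) • z 0 + signSum (fun i => z i.succ) r := by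
        intro s
        simp [signSum, Fin.sum_univ_succ, Fin.consEquiv]
      rw [UnitsInt.univ, Finset.sum_pair (by decide), hs, hs,
        ← parallelogram_law_with_norm ℝ (z 0) (signSum (fun i => z i.succ) r)]
      congr 2
      · simp
      · rw [← norm_neg]; congr 1; simp; ring
    simp_rw [h]
    rw [← Finset.mul_sum, Finset.sum_add_distrib, ih, Fin.sum_univ_succ]
    simp
    ring

/-! ### Averages over signs -/

/-- The average of a function over all choices of signs. -/
noncomputable def signAvg {n : ℕ} (f : (Fin n → ℤˣ) → ℝ≥0∞) : ℝ≥0∞ :=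
  ∑ r, (2 ^ n)⁻¹ * f r

theorem signAvg_eq {n : ℕ} (f : (Fin n → ℤˣ) → ℝ≥0∞) : signAvg f = (2 ^ n)⁻¹ * ∑ r, f r :=
  (Finset.mul_sum _ _ _).symm

theorem signAvg_mono {n : ℕ} {f g : (Fin n → ℤˣ) → ℝ≥0∞} (h : ∀ r, f r ≤ g r) :
    signAvg f ≤ signAvg g :=
  Finset.sum_le_sum fun r _ => mul_le_mul' le_rfl (h r)

theorem signAvg_rpow_le {n : ℕ} (f : (Fin n → ℤˣ) → ℝ≥0∞) {s : ℝ} (hs : 1 ≤ s) :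
    signAvg f ^ s ≤ signAvg fun r => f r ^ s := by
  refine ENNReal.rpow_arith_mean_le_arith_mean_rpow _ _ _ ?_ hs
  simp only [Finset.sum_const, Finset.card_univ, Fintype.card_pi, Fintype.card_units_int,
    Finset.prod_const, Fintype.card_fin, nsmul_eq_mul, Nat.cast_pow, Nat.cast_ofNat]
  exact ENNReal.mul_inv_cancel (by simp) (by simp)

theorem signAvg_mul_le {n : ℕ} (f g : (Fin n → ℤˣ) → ℝ≥0∞) {p q : ℝ}
    (hpq : p.HolderConjugate q) :
    (signAvg fun r => f r * g r) ≤
      (signAvg fun r => f r ^ p) ^ (1 / p) * (signAvg fun r => g r ^ q) ^ (1 / q) := by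
  have h := ENNReal.inner_le_Lp_mul_Lq Finset.univ f g hpq
  have h2 : ((2 : ℝ≥0∞) ^ n)⁻¹ ≠ 0 := by simp
  have h2' : ((2 : ℝ≥0∞) ^ n)⁻¹ ≠ ∞ := by simp
  have hw : ((2 : ℝ≥0∞) ^ n)⁻¹ = ((2 ^ n)⁻¹) ^ (1 / p) * ((2 ^ n)⁻¹) ^ (1 / q) := by
    rw [← ENNReal.rpow_add _ _ h2 h2', one_div, one_div, hpq.inv_add_inv_eq_one,
      ENNReal.rpow_one]
  simp only [signAvg_eq]
  rw [ENNReal.mul_rpow_of_nonneg _ _ hpq.one_div_nonneg,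
    ENNReal.mul_rpow_of_nonneg _ _ hpq.symm.one_div_nonneg]
  calc _ ≤ (2 ^ n)⁻¹ * ((∑ r, f r ^ p) ^ (1 / p) * (∑ r, g r ^ q) ^ (1 / q)) := by gcongr
    _ = _ := by
      conv_lhs => rw [hw]
      ring

theorem signAvg_ne_top {n : ℕ} {f : (Fin n → ℤˣ) → ℝ≥0∞} (h : ∀ r, f r ≠ ∞) :
    signAvg f ≠ ∞ :=
  ENNReal.sum_ne_top.2 fun r _ => ENNReal.mul_ne_top (by simp) (h r)

section Lintegral

variable {α : Type*} [MeasurableSpace α] {μ : Measure α} {n : ℕ}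
  {f : (Fin n → ℤˣ) → α → ℝ≥0∞}

theorem lintegral_signAvg (hf : ∀ r, AEMeasurable (f r) μ) :
    ∫⁻ y, (signAvg fun r => f r y) ∂μ = signAvg fun r => ∫⁻ y, f r y ∂μ := by
  simp only [signAvg]
  rw [lintegral_finsetSum' _ fun r _ => (hf r).const_mul _]
  exact Finset.sum_congr rfl fun r _ => lintegral_const_mul' _ _ (by simp)

theorem aemeasurable_signAvg (hf : ∀ r, AEMeasurable (f r) μ) :
    AEMeasurable (fun y => signAvg fun r => f r y) μ :=
  Finset.aemeasurable_fun_sum _ fun r _ => (hf r).const_mul _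

/-- Minkowski's integral inequality for an average of integrals. -/
theorem signAvg_lintegral_rpow_le (hf : ∀ r, AEMeasurable (f r) μ)
    (hfin : ∀ r, ∫⁻ y, f r y ∂μ ≠ ∞) {s : ℝ} (hs : 1 ≤ s) :
    (signAvg fun r => (∫⁻ y, f r y ∂μ) ^ s) ≤
      (∫⁻ y, (signAvg fun r => f r y ^ s) ^ (1 / s) ∂μ) ^ s := by
  rcases hs.eq_or_lt with rfl | hs
  · simp only [ENNReal.rpow_one, div_one]
    rw [lintegral_signAvg hf]
  have hconj := Real.HolderConjugate.conjExponent hs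
  set t := s.conjExponent
  set A : (Fin n → ℤˣ) → ℝ≥0∞ := fun r => ∫⁻ y, f r y ∂μ
  have hX : (signAvg fun r => A r ^ s) ≠ ∞ := signAvg_ne_top fun r =>
    ENNReal.rpow_ne_top_of_nonneg (by linarith) (hfin r)
  -- Duality over the signs, tested against `A r ^ (s - 1)`: Hölder is applied pointwise in `y`, and
  -- the dual factor is then absorbed.
  refine le_rpow_of_le_mul_rpow hconj hX ?_
  have hAs : ∀ r, A r ^ s = A r * A r ^ (s - 1) := fun r => by
    conv_lhs => rw [show s = 1 + (s - 1) by ring,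
      ENNReal.rpow_add_of_nonneg _ _ zero_le_one (by linarith), ENNReal.rpow_one]
  have hm : ∀ r, AEMeasurable (fun y => f r y * A r ^ (s - 1)) μ := fun r => (hf r).mul_const _
  calc (signAvg fun r => A r ^ s) = signAvg fun r => ∫⁻ y, f r y * A r ^ (s - 1) ∂μ := by
        congr 1
        ext r
        rw [hAs, lintegral_mul_const'' _ (hf r)]
    _ = ∫⁻ y, (signAvg fun r => f r y * A r ^ (s - 1)) ∂μ := (lintegral_signAvg hm).symm
    _ ≤ ∫⁻ y, (signAvg fun r => f r y ^ s) ^ (1 / s) *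
          (signAvg fun r => (A r ^ (s - 1)) ^ t) ^ (1 / t) ∂μ :=
        lintegral_mono fun y => signAvg_mul_le _ _ hconj
    _ = _ := by
        rw [lintegral_mul_const'' _
          ((aemeasurable_signAvg fun r => (hf r).pow_const s).pow_const _)]
        simp_rw [← ENNReal.rpow_mul, hconj.sub_one_mul_conj]
        rfl

/-- Minkowski's inequality for an average of functions. -/
theorem lintegral_signAvg_rpow_le (hf : ∀ r, AEMeasurable (f r) μ) {s : ℝ} (hs : 1 ≤ s)
    (hfin : ∫⁻ y, (signAvg fun r => f r y) ^ s ∂μ ≠ ∞) :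
    ∫⁻ y, (signAvg fun r => f r y) ^ s ∂μ ≤
      (signAvg fun r => (∫⁻ y, f r y ^ s ∂μ) ^ (1 / s)) ^ s := by
  rcases hs.eq_or_lt with rfl | hs
  · simp only [ENNReal.rpow_one, div_one]
    rw [lintegral_signAvg hf]
  have hconj := Real.HolderConjugate.conjExponent hs
  set t := s.conjExponent
  set F : α → ℝ≥0∞ := fun y => signAvg fun r => f r y
  have hF : AEMeasurable F μ := aemeasurable_signAvg hf
  refine le_rpow_of_le_mul_rpow hconj hfin ?_
  have hFs : ∀ y, F y ^ s = F y * F y ^ (s - 1) := fun y => by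
    conv_lhs => rw [show s = 1 + (s - 1) by ring,
      ENNReal.rpow_add_of_nonneg _ _ zero_le_one (by linarith), ENNReal.rpow_one]
  calc ∫⁻ y, F y ^ s ∂μ = ∫⁻ y, (signAvg fun r => f r y * F y ^ (s - 1)) ∂μ := by
        refine lintegral_congr fun y => ?_
        rw [hFs]
        simp only [F, signAvg]
        rw [Finset.sum_mul]
        exact Finset.sum_congr rfl fun r _ => mul_assoc _ _ _
    _ = signAvg fun r => ∫⁻ y, f r y * F y ^ (s - 1) ∂μ :=
        lintegral_signAvg fun r => (hf r).mul (hF.pow_const _)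
    _ ≤ signAvg fun r => (∫⁻ y, f r y ^ s ∂μ) ^ (1 / s) *
          (∫⁻ y, (F y ^ (s - 1)) ^ t ∂μ) ^ (1 / t) :=
        signAvg_mono fun r => ENNReal.lintegral_mul_le_Lp_mul_Lq μ hconj (hf r) (hF.pow_const _)
    _ = _ := by
        simp_rw [← ENNReal.rpow_mul, hconj.sub_one_mul_conj]
        simp only [signAvg]
        rw [Finset.sum_mul]
        exact Finset.sum_congr rfl fun r _ => (mul_assoc _ _ _).symm

end Lintegral

theorem signAvg_ofReal {n : ℕ} (f : (Fin n → ℤˣ) → ℝ) (hf : ∀ r, 0 ≤ f r) :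
    (signAvg fun r => ENNReal.ofReal (f r)) = ENNReal.ofReal ((1 / 2 ^ n) * ∑ r, f r) := by
  rw [signAvg_eq, ENNReal.ofReal_mul (by positivity), ENNReal.ofReal_sum_of_nonneg fun r _ => hf r,
    one_div, ENNReal.ofReal_inv_of_pos (by positivity), ENNReal.ofReal_pow (by positivity)]
  simp

theorem ofReal_sum_norm_sq {n : ℕ} (z : Fin n → ℂ) :
    ENNReal.ofReal (∑ i, ‖z i‖ ^ 2) = ∑ i, ‖z i‖ₑ ^ 2 := by
  rw [ENNReal.ofReal_sum_of_nonneg fun i _ => by positivity]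
  refine Finset.sum_congr rfl fun i _ => ?_
  rw [ENNReal.ofReal_pow (norm_nonneg _), ofReal_norm]

/-- The second moment of a signed sum. -/
theorem signAvg_enorm_sq {n : ℕ} (z : Fin n → ℂ) :
    (signAvg fun r => ‖signSum z r‖ₑ ^ 2) = ∑ i, ‖z i‖ₑ ^ 2 := by
  have : ∀ r, ‖signSum z r‖ₑ ^ 2 = ENNReal.ofReal (‖signSum z r‖ ^ 2) := fun r => by
    rw [ENNReal.ofReal_pow (norm_nonneg _), ofReal_norm]
  simp_rw [this]
  rw [signAvg_ofReal _ fun r => by positivity, sum_norm_signSum_sq, ← mul_assoc, one_div,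
    inv_mul_cancel₀ (by positivity), one_mul, ofReal_sum_norm_sq]

/-- **Khintchine's inequality**, upper bound. -/
theorem exists_signAvg_enorm_rpow_le {q : ℝ} (hq : 0 < q) : ∃ C : ℝ≥0∞, C ≠ ∞ ∧
    ∀ (n : ℕ) (z : Fin n → ℂ),
      (signAvg fun r => ‖signSum z r‖ₑ ^ q) ≤ C * (∑ i, ‖z i‖ₑ ^ 2) ^ (q / 2) := by
  obtain ⟨C, hC, hk⟩ := exists_khintchine_complex q hq
  refine ⟨ENNReal.ofReal C, ENNReal.ofReal_ne_top, fun n z => ?_⟩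
  have : ∀ r, ‖signSum z r‖ₑ ^ q = ENNReal.ofReal (‖signSum z r‖ ^ q) := fun r => by
    rw [← ENNReal.ofReal_rpow_of_nonneg (norm_nonneg _) hq.le, ofReal_norm]
  simp_rw [this]
  rw [signAvg_ofReal _ fun r => by positivity, ← ofReal_sum_norm_sq,
    ENNReal.ofReal_rpow_of_nonneg (Finset.sum_nonneg fun i _ => by positivity) (by positivity),
    ← ENNReal.ofReal_mul hC.le]
  exact ENNReal.ofReal_le_ofReal (hk n z)

/-- **Khintchine's inequality**, lower bound. -/
theorem exists_le_signAvg_enorm_rpow {q : ℝ} (hq : 1 < q) : ∃ C : ℝ≥0∞, C ≠ ∞ ∧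
    ∀ (n : ℕ) (z : Fin n → ℂ),
      (∑ i, ‖z i‖ₑ ^ 2) ^ (q / 2) ≤ C * signAvg fun r => ‖signSum z r‖ₑ ^ q := by
  have hconj := Real.HolderConjugate.conjExponent hq
  set t := q.conjExponent
  obtain ⟨C, hC, hk⟩ := exists_signAvg_enorm_rpow_le hconj.symm.pos
  have hq0 : 0 < q := by linarith
  have ht0 : 0 ≤ 1 / t := hconj.symm.one_div_nonneg
  refine ⟨(C ^ (1 / t)) ^ q, by finiteness, fun n z => ?_⟩
  set S := ∑ i, ‖z i‖ₑ ^ 2 with hS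
  have hSfin : S ≠ ∞ := ENNReal.sum_ne_top.2 fun i _ => by finiteness
  set a := signAvg fun r => ‖signSum z r‖ₑ ^ q
  -- The second moment is exactly `S`. Hölder splits it between the exponents `q` and `t`, and the
  -- upper inequality at `t` leaves a factor `S ^ (1 / 2)` to absorb.
  have h1 : S ≤ a ^ (1 / q) * (C * S ^ (t / 2)) ^ (1 / t) := by
    calc S = signAvg fun r => ‖signSum z r‖ₑ * ‖signSum z r‖ₑ := by
          rw [hS, ← signAvg_enorm_sq]; simp_rw [sq]
      _ ≤ a ^ (1 / q) * (signAvg fun r => ‖signSum z r‖ₑ ^ t) ^ (1 / t) :=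
          signAvg_mul_le _ _ hconj
      _ ≤ _ := by gcongr; exact hk n z
  have h2 : (C * S ^ (t / 2)) ^ (1 / t) = C ^ (1 / t) * S ^ (1 / 2 : ℝ) := by
    rw [ENNReal.mul_rpow_of_nonneg _ _ ht0, ← ENNReal.rpow_mul]
    congr 2
    have := hconj.symm.ne_zero
    field_simp
  rw [h2, ← mul_assoc] at h1
  have h3 := le_rpow_of_le_mul_rpow Real.HolderConjugate.two_two hSfin h1
  calc S ^ (q / 2) ≤ ((a ^ (1 / q) * C ^ (1 / t)) ^ (2 : ℝ)) ^ (q / 2) := by gcongr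
    _ = (a ^ (1 / q) * C ^ (1 / t)) ^ q := by
        rw [← ENNReal.rpow_mul]; congr 1; ring
    _ = _ := by
        rw [ENNReal.mul_rpow_of_nonneg _ _ hq0.le, ← ENNReal.rpow_mul a,
          one_div_mul_cancel hq0.ne', ENNReal.rpow_one, mul_comm]

/-! ### Random sums and square functions in `L^p` -/

theorem ofReal_rademacherNorm_sq {X : Type*} [NormedAddCommGroup X] [NormedSpace ℂ X] {n : ℕ}
    (x : Fin n → X) :
    ENNReal.ofReal (rademacherNorm x) ^ 2 = signAvg fun r => ‖signSum x r‖ₑ ^ 2 := by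
  have : ∀ r, ‖signSum x r‖ₑ ^ 2 = ENNReal.ofReal (‖signSum x r‖ ^ 2) := fun r => by
    rw [ENNReal.ofReal_pow (norm_nonneg _), ofReal_norm]
  simp_rw [this]
  rw [signAvg_ofReal _ fun r => by positivity, rademacherNorm,
    ← ENNReal.ofReal_pow (Real.sqrt_nonneg _), Real.sq_sqrt (by positivity)]
  rfl

section Lp

variable {α : Type*} [MeasurableSpace α] {μ : Measure α} {p : ℝ≥0∞} [Fact (1 ≤ p)]

theorem enorm_rpow_eq_lintegral (hp1 : p ≠ 0) (hp : p ≠ ∞) (f : Lp ℂ p μ) :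
    ‖f‖ₑ ^ p.toReal = ∫⁻ y, ‖f y‖ₑ ^ p.toReal ∂μ := by
  have h0 : p.toReal ≠ 0 := (ENNReal.toReal_pos hp1 hp).ne'
  rw [Lp.enorm_def, eLpNorm_eq_lintegral_rpow_enorm_toReal hp1 hp, ← ENNReal.rpow_mul,
    one_div_mul_cancel h0, ENNReal.rpow_one]

theorem coeFn_signSum {n : ℕ} (x : Fin n → Lp ℂ p μ) (r : Fin n → ℤˣ) :
    ⇑(signSum x r) =ᵐ[μ] fun y => signSum (fun i => x i y) r := by
  have h : ∀ᵐ y ∂μ, ∀ i, (((r i : ℤ) : ℂ) • x i : Lp ℂ p μ) y = ((r i : ℤ) : ℂ) • x i y :=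
    ae_all_iff.2 fun i => Lp.coeFn_smul _ _
  filter_upwards [h, Lp.coeFn_fun_finsetSum Finset.univ fun i => ((r i : ℤ) : ℂ) • x i]
    with y hy1 hy2
  rw [signSum, hy2, signSum]
  exact Finset.sum_congr rfl fun i _ => hy1 i

theorem enorm_signSum_rpow (hp1 : p ≠ 0) (hp : p ≠ ∞) {n : ℕ} (x : Fin n → Lp ℂ p μ)
    (r : Fin n → ℤˣ) :
    ‖signSum x r‖ₑ ^ p.toReal = ∫⁻ y, ‖signSum (fun i => x i y) r‖ₑ ^ p.toReal ∂μ := by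
  rw [enorm_rpow_eq_lintegral hp1 hp]
  refine lintegral_congr_ae ?_
  filter_upwards [coeFn_signSum x r] with y hy
  rw [hy]

theorem aemeasurable_enorm_signSum {n : ℕ} (x : Fin n → Lp ℂ p μ) (r : Fin n → ℤˣ) :
    AEMeasurable (fun y => ‖signSum (fun i => x i y) r‖ₑ) μ :=
  (Lp.aestronglyMeasurable (signSum x r)).enorm.congr <| by
    filter_upwards [coeFn_signSum x r] with y hy
    rw [hy]

/-- Writes the Rademacher norm as a mixed norm, `L²` over signs of `L^p` in space, the form to which
Minkowski and Jensen apply. -/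
theorem ofReal_rademacherNorm_rpow (hp1 : p ≠ 0) (hp : p ≠ ∞) {n : ℕ} (x : Fin n → Lp ℂ p μ) :
    ENNReal.ofReal (rademacherNorm x) ^ p.toReal =
      (signAvg fun r => (∫⁻ y, ‖signSum (fun i => x i y) r‖ₑ ^ p.toReal ∂μ) ^ (2 / p.toReal)) ^
        (p.toReal / 2) := by
  have h0 : p.toReal ≠ 0 := (ENNReal.toReal_pos hp1 hp).ne'
  simp_rw [← enorm_signSum_rpow hp1 hp, ← ENNReal.rpow_mul, mul_div_cancel₀ _ h0]
  have := ofReal_rademacherNorm_sq x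
  simp_rw [← ENNReal.rpow_two] at this ⊢
  rw [← this, ← ENNReal.rpow_mul, mul_div_cancel₀ _ two_ne_zero]

theorem lintegral_square_ne_top (hp1 : p ≠ 0) (hp : p ≠ ∞) {n : ℕ} (x : Fin n → Lp ℂ p μ) :
    ∫⁻ y, (∑ i, ‖x i y‖ₑ ^ 2) ^ (p.toReal / 2) ∂μ ≠ ∞ := by
  have h0 : 0 < p.toReal := ENNReal.toReal_pos hp1 hp
  have hpow : ∀ a : ℝ≥0∞, (a ^ 2) ^ (p.toReal / 2) = a ^ p.toReal := by
    intro a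
    rw [← ENNReal.rpow_two, ← ENNReal.rpow_mul, mul_div_cancel₀ _ two_ne_zero]
  refine ne_top_of_le_ne_top ?_ (lintegral_mono fun y => sum_rpow_le Finset.univ
    (fun i => ‖x i y‖ₑ ^ 2) (by positivity : 0 < p.toReal / 2))
  simp only [hpow]
  rw [lintegral_finsetSum' _ fun i _ =>
    ((Lp.aestronglyMeasurable (x i)).enorm.pow_const _).const_mul _]
  refine ENNReal.sum_ne_top.2 fun i _ => ?_
  rw [lintegral_const_mul' _ _ (by finiteness), ← enorm_rpow_eq_lintegral hp1 hp]
  finiteness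

/-- Random sums in `L^p` are controlled by square functions. -/
theorem exists_rademacherNorm_rpow_le (hp1 : 1 < p) (hp : p ≠ ∞) : ∃ C : ℝ≥0∞, C ≠ ∞ ∧
    ∀ (n : ℕ) (x : Fin n → Lp ℂ p μ), ENNReal.ofReal (rademacherNorm x) ^ p.toReal ≤
      C * ∫⁻ y, (∑ i, ‖x i y‖ₑ ^ 2) ^ (p.toReal / 2) ∂μ := by
  have hp0 : p ≠ 0 := (zero_lt_one.trans hp1).ne'
  have hq0 : 0 < p.toReal := ENNReal.toReal_pos hp0 hp
  -- For `p ≤ 2`, Minkowski moves the `L²` average over signs inside, where the second moment is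
  -- exact. For `p > 2`, Jensen raises that average to `L^p`, after which Tonelli and the upper
  -- Khintchine bound apply.
  rcases le_or_gt p.toReal 2 with h2 | h2
  · refine ⟨1, by simp, fun n x => ?_⟩
    have hs : 1 ≤ 2 / p.toReal := by rwa [le_div_iff₀ hq0, one_mul]
    rw [ofReal_rademacherNorm_rpow hp0 hp, one_mul]
    have h := signAvg_lintegral_rpow_le (μ := μ)
      (f := fun r y => ‖signSum (fun i => x i y) r‖ₑ ^ p.toReal)
      (fun r => (aemeasurable_enorm_signSum x r).pow_const _)
      (fun r => by rw [← enorm_signSum_rpow hp0 hp]; finiteness) hs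
    simp_rw [← ENNReal.rpow_mul, mul_div_cancel₀ _ hq0.ne', one_div_div, ENNReal.rpow_two,
      signAvg_enorm_sq] at h
    calc _ ≤ ((∫⁻ y, (∑ i, ‖x i y‖ₑ ^ 2) ^ (p.toReal / 2) ∂μ) ^ (2 / p.toReal)) ^
          (p.toReal / 2) := by gcongr
      _ = _ := by
        rw [← ENNReal.rpow_mul, div_mul_div_cancel₀ hq0.ne', div_self two_ne_zero,
          ENNReal.rpow_one]
  · obtain ⟨C, hC, hk⟩ := exists_signAvg_enorm_rpow_le hq0
    refine ⟨C, hC, fun n x => ?_⟩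
    rw [ofReal_rademacherNorm_rpow hp0 hp]
    have hs : 1 ≤ p.toReal / 2 := by linarith
    refine (signAvg_rpow_le _ hs).trans ?_
    simp_rw [← ENNReal.rpow_mul, div_mul_div_cancel₀ hq0.ne', div_self (two_ne_zero' ℝ),
      ENNReal.rpow_one]
    rw [← lintegral_signAvg fun r => (aemeasurable_enorm_signSum x r).pow_const _,
      ← lintegral_const_mul' _ _ hC]
    exact lintegral_mono fun y => hk n _

/-- Square functions are controlled by random sums in `L^p`. -/
theorem exists_lintegral_square_le_rademacherNorm (hp1 : 1 < p) (hp : p ≠ ∞) :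
    ∃ C : ℝ≥0∞, C ≠ ∞ ∧ ∀ (n : ℕ) (x : Fin n → Lp ℂ p μ),
      ∫⁻ y, (∑ i, ‖x i y‖ₑ ^ 2) ^ (p.toReal / 2) ∂μ ≤
        C * ENNReal.ofReal (rademacherNorm x) ^ p.toReal := by
  have hp0 : p ≠ 0 := (zero_lt_one.trans hp1).ne'
  have hq0 : 0 < p.toReal := ENNReal.toReal_pos hp0 hp
  have hq1 : 1 < p.toReal := by
    rwa [← ENNReal.toReal_one, ENNReal.toReal_lt_toReal ENNReal.one_ne_top hp]
  -- For `p ≤ 2` the lower Khintchine bound is followed by Jensen; for `p > 2` Minkowski applies in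
  -- the opposite order, again with the exact second moment.
  rcases le_or_gt p.toReal 2 with h2 | h2
  · obtain ⟨C, hC, hk⟩ := exists_le_signAvg_enorm_rpow hq1
    refine ⟨C, hC, fun n x => ?_⟩
    have hs : 1 ≤ 2 / p.toReal := by rwa [le_div_iff₀ hq0, one_mul]
    rw [ofReal_rademacherNorm_rpow hp0 hp]
    set A : (Fin n → ℤˣ) → ℝ≥0∞ :=
      fun r => ∫⁻ y, ‖signSum (fun i => x i y) r‖ₑ ^ p.toReal ∂μ
    have hA : signAvg A ≤ (signAvg fun r => A r ^ (2 / p.toReal)) ^ (p.toReal / 2) := by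
      calc signAvg A = (signAvg A ^ (2 / p.toReal)) ^ (p.toReal / 2) := by
            rw [← ENNReal.rpow_mul, div_mul_div_cancel₀ hq0.ne', div_self two_ne_zero,
              ENNReal.rpow_one]
        _ ≤ _ := by gcongr; exact signAvg_rpow_le A hs
    calc ∫⁻ y, (∑ i, ‖x i y‖ₑ ^ 2) ^ (p.toReal / 2) ∂μ
        ≤ ∫⁻ y, C * (signAvg fun r => ‖signSum (fun i => x i y) r‖ₑ ^ p.toReal) ∂μ :=
          lintegral_mono fun y => hk n _
      _ = C * signAvg A := by
          rw [lintegral_const_mul' _ _ hC,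
            lintegral_signAvg fun r => (aemeasurable_enorm_signSum x r).pow_const _]
      _ ≤ _ := by gcongr
  · refine ⟨1, by simp, fun n x => ?_⟩
    have hs : 1 ≤ p.toReal / 2 := by linarith
    have hfin := lintegral_square_ne_top hp0 hp x
    simp_rw [← signAvg_enorm_sq] at hfin ⊢
    rw [ofReal_rademacherNorm_rpow hp0 hp, one_mul]
    refine (lintegral_signAvg_rpow_le
      (fun r => (aemeasurable_enorm_signSum x r).pow_const _) hs hfin).trans_eq ?_
    simp_rw [← ENNReal.rpow_two, ← ENNReal.rpow_mul, mul_div_cancel₀ _ (two_ne_zero' ℝ),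
      one_div_div]

end Lp

/-! ### The weighted space -/

section Weighted

variable {d : ℕ} {φ : Eucl d → ℝ}

/-- The modulus of `f` transported from `L^q(μ)` to the unweighted `L^q`. -/
noncomputable def weighted (φ : Eucl d → ℝ) (q : ℝ) (f : Eucl d → ℂ) (y : Eucl d) : ℝ≥0∞ :=
  ‖f y‖ₑ * ENNReal.ofReal (Real.exp (-φ y / q))

theorem ofReal_exp_rpow (t q : ℝ) :
    ENNReal.ofReal (Real.exp t) ^ q = ENNReal.ofReal (Real.exp (t * q)) := by
  rw [ENNReal.ofReal_rpow_of_pos (Real.exp_pos t), ← Real.exp_mul]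

theorem ofReal_exp_mul (s t : ℝ) :
    ENNReal.ofReal (Real.exp s) * ENNReal.ofReal (Real.exp t) =
      ENNReal.ofReal (Real.exp (s + t)) := by
  rw [← ENNReal.ofReal_mul (Real.exp_pos s).le, Real.exp_add]

theorem measurable_weighted (hφ : Continuous φ) (q : ℝ) {f : Eucl d → ℂ} (hf : Measurable f) :
    Measurable (weighted φ q f) := by
  have := hφ.measurable
  unfold weighted
  fun_prop

theorem lintegral_withDensity_exp {ψ : Eucl d → ℝ} (hψ : Continuous ψ) (h : Eucl d → ℝ≥0∞) :
    ∫⁻ y, h y ∂(volume.withDensity fun x => ENNReal.ofReal (Real.exp (ψ x))) =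
      ∫⁻ y, ENNReal.ofReal (Real.exp (ψ y)) * h y := by
  have := hψ.measurable
  exact lintegral_withDensity_eq_lintegral_mul_non_measurable _ (by fun_prop)
    (ae_of_all _ fun _ => ENNReal.ofReal_lt_top) h

theorem lintegral_square_weightedMeasure (hφ : Continuous φ) {q : ℝ} (hq : 0 < q) {n : ℕ}
    (f : Fin n → Eucl d → ℂ) :
    ∫⁻ y, (∑ i, ‖f i y‖ₑ ^ 2) ^ (q / 2) ∂(weightedMeasure φ) =
      ∫⁻ y, (∑ i, weighted φ q (f i) y ^ 2) ^ (q / 2) := by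
  rw [weightedMeasure, lintegral_withDensity_exp hφ.fun_neg]
  refine lintegral_congr fun y => ?_
  simp only [weighted, mul_pow]
  rw [← Finset.sum_mul, ENNReal.mul_rpow_of_nonneg _ _ (by positivity), ← ENNReal.rpow_two,
    ← ENNReal.rpow_mul, ofReal_exp_rpow, mul_comm]
  congr 3
  field_simp

theorem lintegral_rpow_weightedMeasure (hφ : Continuous φ) {q : ℝ} (hq : 0 < q)
    (f : Eucl d → ℂ) :
    ∫⁻ y, ‖f y‖ₑ ^ q ∂(weightedMeasure φ) = ∫⁻ y, weighted φ q f y ^ q := by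
  rw [weightedMeasure, lintegral_withDensity_exp hφ.fun_neg]
  refine lintegral_congr fun y => ?_
  rw [weighted, ENNReal.mul_rpow_of_nonneg _ _ hq.le, ofReal_exp_rpow,
    div_mul_cancel₀ _ hq.ne', mul_comm]

theorem weightedMeasure_absolutelyContinuous : weightedMeasure φ ≪ volume :=
  withDensity_absolutelyContinuous _ _

theorem absolutelyContinuous_weightedMeasure (hφ : Continuous φ) :
    volume ≪ weightedMeasure φ := by
  have := hφ.measurable
  refine withDensity_absolutelyContinuous' (by fun_prop) (ae_of_all _ fun x => ?_)
  simp [Real.exp_pos]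

theorem ae_weightedMeasure_iff (hφ : Continuous φ) {P : Eucl d → Prop} :
    (∀ᵐ y ∂(weightedMeasure φ), P y) ↔ ∀ᵐ y, P y :=
  ⟨fun h => (absolutelyContinuous_weightedMeasure hφ).ae_le h,
    fun h => weightedMeasure_absolutelyContinuous.ae_le h⟩

/-- Multiplication by `exp (-φ / 2)` as an isometry between weighted spaces. -/
theorem eLpNorm_weightedMeasure (hφ : Continuous φ) {p : ℝ≥0∞} (hp0 : p ≠ 0) (hp : p ≠ ∞)
    (h : Eucl d → ℂ) :
    eLpNorm h p (weightedMeasure φ) =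
      eLpNorm (fun x => h x * (Real.exp (-φ x / 2) : ℂ)) p
        (volume.withDensity fun x => ENNReal.ofReal (Real.exp ((p.toReal / 2 - 1) * φ x))) := by
  have hq : 0 < p.toReal := ENNReal.toReal_pos hp0 hp
  rw [eLpNorm_eq_lintegral_rpow_enorm_toReal hp0 hp, eLpNorm_eq_lintegral_rpow_enorm_toReal hp0 hp,
    weightedMeasure, lintegral_withDensity_exp hφ.fun_neg,
    lintegral_withDensity_exp (continuous_const.fun_mul hφ)]
  congr 1
  refine lintegral_congr fun y => ?_
  have he : ‖(Real.exp (-φ y / 2) : ℂ)‖ₑ = ENNReal.ofReal (Real.exp (-φ y / 2)) := by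
    rw [← ofReal_norm, Complex.norm_of_nonneg (Real.exp_pos _).le]
  rw [enorm_mul, he, ENNReal.mul_rpow_of_nonneg _ _ hq.le, ofReal_exp_rpow,
    mul_comm (‖h y‖ₑ ^ p.toReal), ← mul_assoc, ofReal_exp_mul]
  congr 3
  ring

/-- The core is dense in `L^p(μ)`. -/
theorem dense_core (hφ : ContDiff ℝ 2 φ) {p : ℝ≥0∞} [hp1 : Fact (1 ≤ p)] (hp : p ≠ ∞) :
    Dense {F : Lp ℂ p (weightedMeasure φ) |
      ∃ (f : Eucl d → ℂ) (hf : f ∈ core φ), F = (memLp_of_mem_core hφ p hf).toLp f} := by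
  have hc : Continuous φ := hφ.continuous
  have hp0 : p ≠ 0 := (zero_lt_one.trans_le hp1.out).ne'
  intro F
  refine (mem_closure_iff_nhds_basis Metric.nhds_basis_closedBall).2 fun δ hδ => ?_
  -- Multiplication by `exp (-φ / 2)` carries the core onto `C_c^∞` and `L^p(μ)` isometrically into
  -- `L^p(ν)`. As `ν` is locally finite, density of `C_c^∞` in `L^p(ν)` applies.
  set ν : Measure (Eucl d) :=
    volume.withDensity fun x => ENNReal.ofReal (Real.exp ((p.toReal / 2 - 1) * φ x))
  have hν : IsLocallyFiniteMeasure ν :=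
    IsLocallyFiniteMeasure.withDensity_ofReal
      (Real.continuous_exp.comp (continuous_const.mul hc))
  set w : Eucl d → ℂ := fun x => F x * (Real.exp (-φ x / 2) : ℂ)
  have hw : MemLp w p ν := by
    refine ⟨?_, ?_⟩
    · have h1 : Measurable (F : Eucl d → ℂ) := (Lp.stronglyMeasurable F).measurable
      have h2 : Measurable fun x => (Real.exp (-φ x / 2) : ℂ) :=
        Continuous.measurable (by fun_prop)
      exact (h1.mul h2).aestronglyMeasurable
    · rw [← eLpNorm_weightedMeasure hc hp0 hp]
      exact Lp.eLpNorm_lt_top F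
  obtain ⟨g, hg1, hg2, hg3⟩ := hw.exist_eLpNorm_sub_le hp hp1.out hδ
  set f : Eucl d → ℂ := fun x => g x * (Real.exp (φ x / 2) : ℂ)
  have hexp : ∀ x, (Real.exp (φ x / 2) : ℂ) * (Real.exp (-φ x / 2) : ℂ) = 1 := by
    intro x
    rw [← Complex.ofReal_mul, ← Real.exp_add]
    have : φ x / 2 + -φ x / 2 = 0 := by ring
    simp [this]
  have hfg : (fun x => f x * (Real.exp (-φ x / 2) : ℂ)) = g := by
    ext x
    simp only [f]
    rw [mul_assoc, hexp, mul_one]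
  have hf : f ∈ core φ := by
    refine ⟨?_, ?_⟩ <;> rw [hfg]
    · exact hg2
    · exact hg1
  refine ⟨_, ⟨f, hf, rfl⟩, ?_⟩
  rw [mem_closedBall, dist_comm, dist_eq_norm, ← ENNReal.ofReal_le_ofReal_iff hδ.le, ofReal_norm,
    Lp.enorm_def]
  calc eLpNorm (⇑(F - (memLp_of_mem_core hφ p hf).toLp f)) p (weightedMeasure φ)
      = eLpNorm (fun x => F x - f x) p (weightedMeasure φ) := by
        refine eLpNorm_congr_ae ?_
        filter_upwards [Lp.coeFn_sub F ((memLp_of_mem_core hφ p hf).toLp f),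
          (memLp_of_mem_core hφ p hf).coeFn_toLp] with x h1 h2
        rw [h1, Pi.sub_apply, h2]
    _ = eLpNorm (w - g) p ν := by
        rw [eLpNorm_weightedMeasure hc hp0 hp]
        congr 1
        ext x
        rw [← hfg]
        simp only [w, Pi.sub_apply]
        ring
    _ ≤ _ := hg3

end Weighted

/-! ### Kernel bounds for the Weyl calculus -/

section Weyl

variable {d : ℕ} {φ : Eucl d → ℝ} {c : ℝ} {p : ℝ≥0∞} {M : Eucl d → Eucl d} {ε : ℝ}

/-- A dominating function may be replaced by a measurable kernel. -/
theorem exists_measurable_kernel {G : Eucl d → ℝ} {g : Eucl d × Eucl d →ₘ[volume] ℂ}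
    (hG : Dominates G g) : ∃ k : Eucl d → ℝ≥0∞, Measurable k ∧
      majorantIntegral volume k = radialMajorantNorm G ∧
      ∀ᵐ z : Eucl d × Eucl d, ‖g z‖ₑ ≤ k z.2 := by
  have hm : AEMeasurable (fun y => ‖G y‖ₑ) := hG.1.aestronglyMeasurable.enorm
  refine ⟨hm.mk, hm.measurable_mk, ?_, ?_⟩
  · refine lintegral_congr fun x => essSup_congr_ae ?_
    exact ae_restrict_of_ae hm.ae_eq_mk.symm
  · have h2 : ∀ᵐ z : Eucl d × Eucl d, ‖G z.2‖ₑ = hm.mk _ z.2 :=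
      Measure.quasiMeasurePreserving_snd.ae hm.ae_eq_mk
    filter_upwards [hG.2, h2] with z hz1 hz2
    rw [← hz2, ← ofReal_norm, ← ofReal_norm]
    exact ENNReal.ofReal_le_ofReal (hz1.le.trans (le_abs_self _))

/-- The bound on `g_a` holds only almost everywhere, whereas the kernel is evaluated at midpoints.
For fixed `z` the midpoint is an invertible affine function of `y`, so null sets pull back to null
sets; Fubini then exchanges the quantifiers. -/
theorem ae_ae_midpoint (hc : 0 < c) {P : Eucl d × Eucl d → Prop} (hP : MeasurableSet {z | P z})
    (h : ∀ᵐ z, P z) :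
    ∀ᵐ y : Eucl d, ∀ᵐ z : Eucl d, P ((1 / (2 * c)) • (y + c • z + y), z) := by
  have h1 : ∀ᵐ z : Eucl d, ∀ᵐ m : Eucl d, P (m, z) := by
    rw [← Measure.ae_ae_comm (p := fun m z => P (m, z)) hP]
    exact Measure.ae_ae_of_ae_prod h
  have hm : Measurable fun w : Eucl d × Eucl d =>
      ((1 / (2 * c)) • (w.1 + c • w.2 + w.1), w.2) := by fun_prop
  rw [Measure.ae_ae_comm (p := fun y z => P ((1 / (2 * c)) • (y + c • z + y), z)) (hm hP)]
  filter_upwards [h1] with z hz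
  have hS : MeasurableSet {m : Eucl d | ¬ P (m, z)} :=
    (measurable_prodMk_right (y := z) hP).compl
  rw [ae_iff] at hz ⊢
  have heq : ∀ y : Eucl d, (1 / (2 * c)) • (y + c • z + y) = (1 / 2 : ℝ) • z + (1 / c) • y := by
    intro y
    have h2 : y + c • z + y = (2 : ℝ) • y + c • z := by rw [two_smul]; abel
    rw [h2, smul_add, smul_smul, smul_smul, add_comm]
    congr 2 <;> field_simp
  have hmeas : MeasurableSet {y : Eucl d | ¬ P ((1 / (2 * c)) • (y + c • z + y), z)} :=
    hS.preimage (f := fun y : Eucl d => (1 / (2 * c)) • (y + c • z + y)) (by fun_prop)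
  have hint := lintegral_comp_add_smul volume ({m : Eucl d | ¬ P (m, z)}.indicator 1)
    ((1 / 2 : ℝ) • z) (one_div_ne_zero hc.ne')
  rw [lintegral_indicator_one hS, hz, mul_zero] at hint
  rw [← lintegral_indicator_one hmeas, ← hint]
  refine lintegral_congr fun y => ?_
  rw [← heq]
  rfl

/-- In exponents, `(1/2 - 1/p) (φ y - φ x)` is at most `|1/2 - 1/p| |φ x - φ y|`, which the growth
condition bounds by the decay exponent plus `ε`. -/
theorem exp_growth_le (hMε : IsValidGrowthPair c φ p M ε) (x y : Eucl d) :
    Real.exp (-|⟪M ((1 / (2 * c)) • (x + y)), (1 / c) • (x - y)⟫|) *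
        Real.exp ((φ y - φ x) / 2) ≤
      Real.exp ε * Real.exp (φ y / p.toReal) * Real.exp (-φ x / p.toReal) := by
  rw [← Real.exp_add, ← Real.exp_add, ← Real.exp_add]
  refine Real.exp_le_exp.2 ?_
  have h := (abs_le.1 (hMε.2.2 x y)).2
  rw [real_inner_comm, ENNReal.toReal_inv] at h
  have h2 : (1 / 2 - p.toReal⁻¹) * (φ y - φ x) ≤ |1 / 2 - p.toReal⁻¹| * |φ x - φ y| := by
    rw [abs_sub_comm (φ x), ← abs_mul]
    exact le_abs_self _
  have h3 : φ y / p.toReal + -φ x / p.toReal = p.toReal⁻¹ * (φ y - φ x) := by ring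
  linarith

/-- The integrand defining `a(Q, P) f`. -/
noncomputable def weylIntegrand (c : ℝ) (φ : Eucl d → ℝ) (a : HS0 M) (f : Eucl d → ℂ)
    (y x : Eucl d) : ℂ :=
  fourier2 a ((1 / (2 * c)) • (x + y)) ((1 / c) • (x - y)) *
    (Real.exp ((φ y - φ x) / 2) : ℂ) * f x

theorem enorm_weylIntegrand_le (hMε : IsValidGrowthPair c φ p M ε) (a : HS0 M)
    (f : Eucl d → ℂ) (x y : Eucl d) :
    ‖weylIntegrand c φ a f y x‖ₑ ≤
      ENNReal.ofReal ((2 * Real.pi) ^ ((d : ℝ) / 2) *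
          (Real.exp ε * Real.exp (φ y / p.toReal))) *
        (‖stripFactor a ((1 / (2 * c)) • (x + y), (1 / c) • (x - y))‖ₑ *
          weighted φ p.toReal f x) := by
  have hreal : ∀ t : ℝ, 0 ≤ t → ‖(t : ℂ)‖ₑ = ENNReal.ofReal t := fun t ht => by
    rw [← ofReal_norm, Complex.norm_of_nonneg ht]
  have h2 : (0 : ℝ) ≤ (2 * Real.pi) ^ ((d : ℝ) / 2) := by positivity
  simp only [weylIntegrand, fourier2, enorm_mul, weighted]
  rw [hreal _ h2, hreal _ (Real.exp_pos _).le, hreal _ (Real.exp_pos _).le]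
  set g := ‖stripFactor a ((1 / (2 * c)) • (x + y), (1 / c) • (x - y))‖ₑ
  have h := ENNReal.ofReal_le_ofReal (exp_growth_le hMε x y)
  rw [ENNReal.ofReal_mul (by positivity), ENNReal.ofReal_mul (by positivity)] at h
  rw [ENNReal.ofReal_mul h2]
  calc _ = ENNReal.ofReal ((2 * Real.pi) ^ ((d : ℝ) / 2)) * g * ‖f x‖ₑ *
        (ENNReal.ofReal (Real.exp (-|⟪M ((1 / (2 * c)) • (x + y)), (1 / c) • (x - y)⟫|)) *
          ENNReal.ofReal (Real.exp ((φ y - φ x) / 2))) := by ring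
    _ ≤ ENNReal.ofReal ((2 * Real.pi) ^ ((d : ℝ) / 2)) * g * ‖f x‖ₑ *
        (ENNReal.ofReal (Real.exp ε * Real.exp (φ y / p.toReal)) *
          ENNReal.ofReal (Real.exp (-φ x / p.toReal))) := by gcongr
    _ = _ := by ring

variable {a : HS0 M} {k : Eucl d → ℝ≥0∞}

/-- The substitution `x = y + c z` turns the kernel argument `(x - y) / c` into `z` and contributes
`c ^ d`. The exceptional null set of `y` does not depend on `f`. -/
theorem lintegral_weylIntegrand_le (hc : 0 < c) (hMε : IsValidGrowthPair c φ p M ε)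
    (hk : Measurable k) (hg : ∀ᵐ z : Eucl d × Eucl d, ‖stripFactor a z‖ₑ ≤ k z.2) :
    ∀ᵐ y : Eucl d, ∀ f : Eucl d → ℂ, ∫⁻ x, ‖weylIntegrand c φ a f y x‖ₑ ≤
      ENNReal.ofReal ((2 * Real.pi) ^ ((d : ℝ) / 2) * c ^ d *
        (Real.exp ε * Real.exp (φ y / p.toReal))) *
          kernelOp volume k c (weighted φ p.toReal f) y := by
  have hP : MeasurableSet {z : Eucl d × Eucl d | ‖stripFactor a z‖ₑ ≤ k z.2} :=
    measurableSet_le (stripFactor a).stronglyMeasurable.enorm (hk.comp measurable_snd)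
  filter_upwards [ae_ae_midpoint hc hP hg] with y hy f
  have hcd : (0 : ℝ) < c ^ d := by positivity
  have hch := lintegral_comp_add_smul volume (fun x => ‖weylIntegrand c φ a f y x‖ₑ) y hc.ne'
  rw [finrank_euclideanSpace_fin, abs_of_pos (by positivity)] at hch
  have hch' : ∫⁻ x, ‖weylIntegrand c φ a f y x‖ₑ =
      ENNReal.ofReal (c ^ d) * ∫⁻ z, ‖weylIntegrand c φ a f y (y + c • z)‖ₑ := by
    rw [hch, ← mul_assoc, ← ENNReal.ofReal_mul hcd.le, mul_inv_cancel₀ hcd.ne']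
    simp
  rw [hch']
  set K : ℝ := (2 * Real.pi) ^ ((d : ℝ) / 2) * (Real.exp ε * Real.exp (φ y / p.toReal)) with hK
  calc ENNReal.ofReal (c ^ d) * ∫⁻ z, ‖weylIntegrand c φ a f y (y + c • z)‖ₑ
      ≤ ENNReal.ofReal (c ^ d) * ∫⁻ z, ENNReal.ofReal K *
          (k z * weighted φ p.toReal f (y + c • z)) := by
        gcongr ENNReal.ofReal (c ^ d) * ?_
        refine lintegral_mono_ae ?_
        filter_upwards [hy] with z hz
        refine (enorm_weylIntegrand_le hMε a f _ y).trans ?_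
        have h1 : (1 / c) • (y + c • z - y) = z := by
          rw [add_sub_cancel_left, smul_smul, one_div_mul_cancel hc.ne', one_smul]
        rw [h1]
        gcongr
    _ = _ := by
        rw [lintegral_const_mul' _ _ ENNReal.ofReal_ne_top, ← mul_assoc,
          ← ENNReal.ofReal_mul hcd.le, kernelOp, hK]
        congr 2
        ring

theorem weighted_weylAction_le (hc : 0 < c) (hMε : IsValidGrowthPair c φ p M ε)
    (hk : Measurable k) (hg : ∀ᵐ z : Eucl d × Eucl d, ‖stripFactor a z‖ₑ ≤ k z.2) :
    ∀ᵐ y : Eucl d, ∀ f : Eucl d → ℂ, weighted φ p.toReal (weylAction c φ a f) y ≤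
      ENNReal.ofReal (Real.exp ε) * kernelOp volume k c (weighted φ p.toReal f) y := by
  filter_upwards [lintegral_weylIntegrand_le hc hMε hk hg] with y hy f
  set B : ℝ := (2 * Real.pi) ^ ((d : ℝ) / 2) * c ^ d
  have hB : 0 < B := by positivity
  have h1 : ‖weylAction c φ a f y‖ₑ ≤
      ENNReal.ofReal (1 / B) * ∫⁻ x, ‖weylIntegrand c φ a f y x‖ₑ := by
    rw [weylAction, enorm_mul, ← ofReal_norm (((1 / B : ℝ) : ℂ)),
      Complex.norm_of_nonneg (by positivity)]
    gcongr
    exact enorm_integral_le_lintegral_enorm _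
  calc weighted φ p.toReal (weylAction c φ a f) y
      ≤ (ENNReal.ofReal (1 / B) * (ENNReal.ofReal (B *
        (Real.exp ε * Real.exp (φ y / p.toReal))) *
          kernelOp volume k c (weighted φ p.toReal f) y)) *
            ENNReal.ofReal (Real.exp (-φ y / p.toReal)) := by
        rw [weighted]
        gcongr
        exact h1.trans (by gcongr; exact hy f)
    _ = ENNReal.ofReal (1 / B * (B * (Real.exp ε * Real.exp (φ y / p.toReal))) *
          Real.exp (-φ y / p.toReal)) * kernelOp volume k c (weighted φ p.toReal f) y := by
        rw [ENNReal.ofReal_mul (by positivity : 0 ≤ 1 / B *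
          (B * (Real.exp ε * Real.exp (φ y / p.toReal)))),
          ENNReal.ofReal_mul (by positivity : 0 ≤ 1 / B)]
        ring
    _ = _ := by
        congr 2
        have : Real.exp (φ y / p.toReal) * Real.exp (-φ y / p.toReal) = 1 := by
          rw [← Real.exp_add, neg_div, add_neg_cancel, Real.exp_zero]
        calc _ = (1 / B * B) * Real.exp ε *
              (Real.exp (φ y / p.toReal) * Real.exp (-φ y / p.toReal)) := by ring
          _ = _ := by rw [this, one_div_mul_cancel hB.ne']; ring

theorem stronglyMeasurable_weylIntegrand (hφ : Continuous φ) (hM : Measurable M) (a : HS0 M)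
    {f : Eucl d → ℂ} (hf : Measurable f) :
    StronglyMeasurable fun w : Eucl d × Eucl d => weylIntegrand c φ a f w.1 w.2 := by
  have hg := (stripFactor a).stronglyMeasurable.measurable
  have := hφ.measurable
  refine Measurable.stronglyMeasurable ?_
  unfold weylIntegrand fourier2
  fun_prop

theorem stronglyMeasurable_weylAction (hφ : Continuous φ) (hM : Measurable M) (a : HS0 M)
    {f : Eucl d → ℂ} (hf : Measurable f) : StronglyMeasurable (weylAction c φ a f) :=
  (stronglyMeasurable_weylIntegrand hφ hM a hf).integral_prod_right.const_mul _

theorem weylAction_congr (hφ : Continuous φ) {f g : Eucl d → ℂ}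
    (h : f =ᵐ[weightedMeasure φ] g) : weylAction c φ a f = weylAction c φ a g := by
  ext y
  rw [weylAction, weylAction]
  congr 1
  refine integral_congr_ae ?_
  filter_upwards [(ae_weightedMeasure_iff hφ).1 h] with x hx
  rw [hx]

/-- Needed for additivity of the Bochner integral in `f`. The scalar `L^p` bound makes the
dominating convolution finite almost everywhere. -/
theorem ae_integrable_weylIntegrand [Fact (1 ≤ p)] (hc : 0 < c) (hφ : Continuous φ) (hp1 : 1 < p) (hp : p ≠ ∞)
    (hMε : IsValidGrowthPair c φ p M ε) (hk : Measurable k)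
    (hkN : majorantIntegral volume k ≠ ∞)
    (hg : ∀ᵐ z : Eucl d × Eucl d, ‖stripFactor a z‖ₑ ≤ k z.2)
    (f : Lp ℂ p (weightedMeasure φ)) :
    ∀ᵐ y : Eucl d, Integrable (weylIntegrand c φ a f y) := by
  have hp0 : p ≠ 0 := (zero_lt_one.trans hp1).ne'
  have hq1 : 1 < p.toReal := by
    rwa [← ENNReal.toReal_one, ENNReal.toReal_lt_toReal ENNReal.one_ne_top hp]
  have hq0 : 0 < p.toReal := by linarith
  have hf : Measurable (f : Eucl d → ℂ) := (Lp.stronglyMeasurable f).measurable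
  have hw := measurable_weighted hφ p.toReal hf
  obtain ⟨C, hC, hb⟩ := exists_lintegral_kernelOp_rpow_le (volume : Measure (Eucl d)) hq1 hkN
  have h1 : ∫⁻ y, kernelOp volume k c (weighted φ p.toReal f) y ^ p.toReal ≠ ∞ := by
    refine ne_top_of_le_ne_top ?_ (hb k c _ le_rfl hc.ne' hw)
    rw [← lintegral_rpow_weightedMeasure hφ hq0]
    have : ∫⁻ y, ‖f y‖ₑ ^ p.toReal ∂(weightedMeasure φ) ≠ ∞ := by
      rw [← enorm_rpow_eq_lintegral hp0 hp]; finiteness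
    finiteness
  filter_upwards [lintegral_weylIntegrand_le hc hMε hk hg,
    ae_lt_top ((measurable_kernelOp volume hk hw c).pow_const _) h1] with y hy1 hy2
  refine ⟨((stronglyMeasurable_weylIntegrand hφ hMε.1 a hf).comp_measurable
    (measurable_prodMk_left (x := y))).aestronglyMeasurable, (hy1 f).trans_lt ?_⟩
  have : kernelOp volume k c (weighted φ p.toReal f) y ≠ ∞ := by
    intro h
    rw [h, ENNReal.top_rpow_of_pos hq0] at hy2
    exact hy2.ne rfl
  exact ENNReal.mul_lt_top ENNReal.ofReal_lt_top this.lt_top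

theorem exists_lintegral_square_weylAction_le [Fact (1 ≤ p)] (hc : 0 < c) (hφ : Continuous φ) (hp1 : 1 < p)
    (hp : p ≠ ∞) (hMε : IsValidGrowthPair c φ p M ε) {N : ℝ≥0∞} (hN : N ≠ ∞) :
    ∃ C : ℝ≥0∞, C ≠ ∞ ∧ ∀ (n : ℕ) (a : Fin n → HS0 M) (k : Fin n → Eucl d → ℝ≥0∞)
      (x : Fin n → Lp ℂ p (weightedMeasure φ)), (∀ i, Measurable (k i)) →
      (∀ i, majorantIntegral volume (k i) ≤ N) →
      (∀ i, ∀ᵐ z : Eucl d × Eucl d, ‖stripFactor (a i) z‖ₑ ≤ k i z.2) →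
      ∫⁻ y, (∑ i, ‖weylAction c φ (a i) (x i) y‖ₑ ^ 2) ^ (p.toReal / 2) ∂(weightedMeasure φ) ≤
        C * ∫⁻ y, (∑ i, ‖x i y‖ₑ ^ 2) ^ (p.toReal / 2) ∂(weightedMeasure φ) := by
  have hp0 : p ≠ 0 := (zero_lt_one.trans hp1).ne'
  have hq1 : 1 < p.toReal := by
    rwa [← ENNReal.toReal_one, ENNReal.toReal_lt_toReal ENNReal.one_ne_top hp]
  have hq0 : 0 < p.toReal := by linarith
  obtain ⟨C, hC, hb⟩ := exists_lintegral_square_kernelOp_le (volume : Measure (Eucl d)) hq1 hN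
  refine ⟨(ENNReal.ofReal (Real.exp ε) ^ 2) ^ (p.toReal / 2) * C, by finiteness,
    fun n a k x hk hkN hg => ?_⟩
  have hw : ∀ i, Measurable (weighted φ p.toReal (x i)) := fun i =>
    measurable_weighted hφ _ (Lp.stronglyMeasurable (x i)).measurable
  have hfin := lintegral_square_ne_top hp0 hp x
  rw [lintegral_square_weightedMeasure hφ hq0] at hfin ⊢
  rw [lintegral_square_weightedMeasure hφ hq0, mul_assoc]
  calc ∫⁻ y, (∑ i, weighted φ p.toReal (weylAction c φ (a i) (x i)) y ^ 2) ^ (p.toReal / 2)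
      ≤ ∫⁻ y, (ENNReal.ofReal (Real.exp ε) ^ 2) ^ (p.toReal / 2) *
          (∑ i, kernelOp volume (k i) c (weighted φ p.toReal (x i)) y ^ 2) ^ (p.toReal / 2) := by
        refine lintegral_mono_ae ?_
        filter_upwards [ae_all_iff.2 fun i => weighted_weylAction_le hc hMε (hk i) (hg i)]
          with y hy
        rw [← ENNReal.mul_rpow_of_nonneg _ _ (by positivity), Finset.mul_sum]
        gcongr with i
        rw [← mul_pow]
        gcongr
        exact hy i (x i)
    _ = (ENNReal.ofReal (Real.exp ε) ^ 2) ^ (p.toReal / 2) *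
          ∫⁻ y, (∑ i, kernelOp volume (k i) c (weighted φ p.toReal (x i)) y ^ 2) ^
            (p.toReal / 2) := lintegral_const_mul' _ _ (by finiteness)
    _ ≤ _ := by
        gcongr
        exact hb n k _ c hc.ne' hk hw hkN hfin

/-- `a(Q, P)` defines a bounded operator on `L^p(μ)`, given by its integral formula. -/
theorem exists_weylOperator [Fact (1 ≤ p)] (hc : 0 < c) (hφ : Continuous φ) (hp1 : 1 < p)
    (hp : p ≠ ∞) (hMε : IsValidGrowthPair c φ p M ε) (hk : Measurable k)
    (hkN : majorantIntegral volume k ≠ ∞)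
    (hg : ∀ᵐ z : Eucl d × Eucl d, ‖stripFactor a z‖ₑ ≤ k z.2) :
    ∃ T : Lp ℂ p (weightedMeasure φ) →L[ℂ] Lp ℂ p (weightedMeasure φ),
      ∀ f, T f =ᵐ[weightedMeasure φ] weylAction c φ a f := by
  have hp0 : p ≠ 0 := (zero_lt_one.trans hp1).ne'
  have hq0 : 0 < p.toReal := ENNReal.toReal_pos hp0 hp
  obtain ⟨C, hC, hb⟩ := exists_lintegral_square_weylAction_le hc hφ hp1 hp hMε hkN
  have hpow : ∀ t : ℝ≥0∞, (t ^ 2) ^ (p.toReal / 2) = t ^ p.toReal := by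
    intro t
    rw [← ENNReal.rpow_two, ← ENNReal.rpow_mul, mul_div_cancel₀ _ two_ne_zero]
  have hbound : ∀ f : Lp ℂ p (weightedMeasure φ),
      ∫⁻ y, ‖weylAction c φ a f y‖ₑ ^ p.toReal ∂(weightedMeasure φ) ≤ C * ‖f‖ₑ ^ p.toReal := by
    intro f
    -- Boundedness of a single operator is the case `n = 1` of the square function estimate.
    have := hb 1 (fun _ => a) (fun _ => k) (fun _ => f) (fun _ => hk) (fun _ => le_rfl)
      (fun _ => hg)
    simpa only [Finset.univ_unique, Finset.sum_singleton, hpow,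
      ← enorm_rpow_eq_lintegral hp0 hp] using this
  have heLp : ∀ f : Lp ℂ p (weightedMeasure φ),
      eLpNorm (weylAction c φ a f) p (weightedMeasure φ) ≤ C ^ (1 / p.toReal) * ‖f‖ₑ := by
    intro f
    rw [eLpNorm_eq_lintegral_rpow_enorm_toReal hp0 hp]
    calc _ ≤ (C * ‖f‖ₑ ^ p.toReal) ^ (1 / p.toReal) := by gcongr; exact hbound f
      _ = _ := by
        rw [ENNReal.mul_rpow_of_nonneg _ _ (by positivity), ← ENNReal.rpow_mul,
          mul_one_div_cancel hq0.ne', ENNReal.rpow_one]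
  have hCq : C ^ (1 / p.toReal) ≠ ∞ := by finiteness
  have hmem : ∀ f : Lp ℂ p (weightedMeasure φ),
      MemLp (weylAction c φ a f) p (weightedMeasure φ) := fun f =>
    ⟨(stronglyMeasurable_weylAction hφ hMε.1 a
      (Lp.stronglyMeasurable f).measurable).aestronglyMeasurable,
      (heLp f).trans_lt (ENNReal.mul_lt_top hCq.lt_top enorm_lt_top)⟩
  have hint := fun f => ae_integrable_weylIntegrand hc hφ hp1 hp hMε hk hkN hg f
  let L : Lp ℂ p (weightedMeasure φ) →ₗ[ℂ] Lp ℂ p (weightedMeasure φ) :=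
    { toFun := fun f => (hmem f).toLp _
      map_add' := by
        intro f g
        rw [← MemLp.toLp_add, MemLp.toLp_eq_toLp_iff,
          weylAction_congr hφ (Lp.coeFn_add f g), Filter.EventuallyEq,
          ae_weightedMeasure_iff hφ]
        filter_upwards [hint f, hint g] with y hy1 hy2
        rw [Pi.add_apply, weylAction, weylAction, weylAction, ← mul_add]
        congr 1
        refine Eq.trans ?_ (integral_add hy1 hy2)
        refine integral_congr_ae (ae_of_all _ fun x => ?_)
        simp only [Pi.add_apply, mul_add]
      map_smul' := by
        intro s f
        rw [RingHom.id_apply, ← MemLp.toLp_const_smul, MemLp.toLp_eq_toLp_iff,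
          weylAction_congr hφ (Lp.coeFn_smul s f)]
        refine ae_of_all _ fun y => ?_
        rw [Pi.smul_apply, weylAction, weylAction, smul_eq_mul, mul_left_comm]
        congr 1
        rw [← integral_const_mul]
        refine integral_congr_ae (ae_of_all _ fun x => ?_)
        simp only [Pi.smul_apply, smul_eq_mul]
        ring }
  refine ⟨L.mkContinuous (C ^ (1 / p.toReal)).toReal fun f => ?_, fun f => (hmem f).coeFn_toLp⟩
  have h : ‖L f‖ₑ ≤ C ^ (1 / p.toReal) * ‖f‖ₑ := by
    rw [Lp.enorm_def]
    exact (eLpNorm_congr_ae (hmem f).coeFn_toLp).trans_le (heLp f)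
  have h2 := ENNReal.toReal_mono (by finiteness) h
  simpa [ENNReal.toReal_mul] using h2

theorem IsWeylExtension.eq [Fact (1 ≤ p)] (hφ : ContDiff ℝ 2 φ) (hp : p ≠ ∞)
    {T S : Lp ℂ p (weightedMeasure φ) →L[ℂ] Lp ℂ p (weightedMeasure φ)}
    (hT : IsWeylExtension c hφ p a T) (hS : IsWeylExtension c hφ p a S) : T = S := by
  refine DFunLike.coe_injective (Continuous.ext_on (dense_core hφ hp) T.continuous S.continuous ?_)
  rintro F ⟨f, hf, rfl⟩
  exact Lp.ext ((hT f hf).trans (hS f hf).symm)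

theorem isWeylExtension_of_ae_eq [Fact (1 ≤ p)] (hφ : ContDiff ℝ 2 φ)
    {T : Lp ℂ p (weightedMeasure φ) →L[ℂ] Lp ℂ p (weightedMeasure φ)}
    (hT : ∀ f, T f =ᵐ[weightedMeasure φ] weylAction c φ a f) : IsWeylExtension c hφ p a T := by
  intro f hf
  have h := weylAction_congr (c := c) (a := a) hφ.continuous
    (memLp_of_mem_core hφ p hf).coeFn_toLp
  rw [← h]
  exact hT _

end Weyl

end GenWeyl

/-! ### Unique extension and R-boundedness -/

theorem mainTheorem5 (d : ℕ) (c : ℝ) (hc : 0 < c) (p : ℝ≥0∞) [Fact (1 ≤ p)]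
    (hp1 : 1 < p) (hp : p < ∞)
    (φ : GenWeyl.Eucl d → ℝ) (hφ : ContDiff ℝ 2 φ)
    (M : GenWeyl.Eucl d → GenWeyl.Eucl d) (ε : ℝ)
    (hMε : GenWeyl.IsValidGrowthPair c φ p M ε)
    (A : Set (GenWeyl.HS0 M)) (G : GenWeyl.HS0 M → GenWeyl.Eucl d → ℝ)
    (hG : ∀ a ∈ A, GenWeyl.Dominates (G a) (GenWeyl.stripFactor a))
    (hsup : (⨆ a ∈ A, GenWeyl.radialMajorantNorm (G a)) < ∞) :
    (∀ a ∈ A, ∃! T : Lp ℂ p (GenWeyl.weightedMeasure φ) →L[ℂ]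
        Lp ℂ p (GenWeyl.weightedMeasure φ), GenWeyl.IsWeylExtension c hφ p a T) ∧
    GenWeyl.IsRBounded {T : Lp ℂ p (GenWeyl.weightedMeasure φ) →L[ℂ]
        Lp ℂ p (GenWeyl.weightedMeasure φ) |
          ∃ a ∈ A, GenWeyl.IsWeylExtension c hφ p a T} := by
  open GenWeyl in
  have hφc := hφ.continuous
  have hp0 : p ≠ 0 := (zero_lt_one.trans hp1).ne'
  have hq0 : 0 < p.toReal := ENNReal.toReal_pos hp0 hp.ne
  set N := ⨆ a ∈ A, GenWeyl.radialMajorantNorm (G a)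
  have hker : ∀ a ∈ A, ∃ k : Eucl d → ℝ≥0∞, Measurable k ∧ majorantIntegral volume k ≤ N ∧
      ∀ᵐ z : Eucl d × Eucl d, ‖stripFactor a z‖ₑ ≤ k z.2 := by
    intro a ha
    obtain ⟨k, hk, hkG, hg⟩ := exists_measurable_kernel (hG a ha)
    exact ⟨k, hk, hkG.trans_le (le_iSup₂ (f := fun a _ => radialMajorantNorm (G a)) a ha), hg⟩
  have hop : ∀ a ∈ A, ∃ T : Lp ℂ p (weightedMeasure φ) →L[ℂ] Lp ℂ p (weightedMeasure φ),
      ∀ f, T f =ᵐ[weightedMeasure φ] weylAction c φ a f := by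
    intro a ha
    obtain ⟨k, hk, hkN, hg⟩ := hker a ha
    exact exists_weylOperator hc hφc hp1 hp.ne hMε hk (ne_top_of_le_ne_top hsup.ne hkN) hg
  refine ⟨fun a ha => ?_, ?_⟩
  · obtain ⟨T, hT⟩ := hop a ha
    exact ⟨T, isWeylExtension_of_ae_eq hφ hT, fun S hS =>
      hS.eq hφ hp.ne (isWeylExtension_of_ae_eq hφ hT)⟩
  obtain ⟨C₁, hC₁, h₁⟩ := exists_rademacherNorm_rpow_le (μ := weightedMeasure φ) hp1 hp.ne
  obtain ⟨C₂, hC₂, h₂⟩ :=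
    exists_lintegral_square_le_rademacherNorm (μ := weightedMeasure φ) hp1 hp.ne
  obtain ⟨C, hC, hb⟩ := exists_lintegral_square_weylAction_le hc hφc hp1 hp.ne hMε hsup.ne
  set K := (C₁ * (C * C₂)) ^ (1 / p.toReal)
  have hK : K ≠ ∞ := by finiteness
  refine ⟨K.toReal, fun n T x hT => ?_⟩
  choose a haA haT using hT
  choose k hk hkN hg using fun i => hker (a i) (haA i)
  -- The operators `T i` are prescribed only on the core; uniqueness of the extension gives them the
  -- integral formula on all of `L^p(μ)`.
  have hTw : ∀ i, T i (x i) =ᵐ[weightedMeasure φ] weylAction c φ (a i) (x i) := by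
    intro i
    obtain ⟨S, hS⟩ := hop (a i) (haA i)
    rw [(haT i).eq hφ hp.ne (isWeylExtension_of_ae_eq hφ hS)]
    exact hS (x i)
  have hsq : ∫⁻ y, (∑ i, ‖T i (x i) y‖ₑ ^ 2) ^ (p.toReal / 2) ∂(weightedMeasure φ) =
      ∫⁻ y, (∑ i, ‖weylAction c φ (a i) (x i) y‖ₑ ^ 2) ^ (p.toReal / 2)
        ∂(weightedMeasure φ) := by
    refine lintegral_congr_ae ?_
    filter_upwards [ae_all_iff.2 hTw] with y hy
    simp_rw [hy]
  have key : ENNReal.ofReal (rademacherNorm fun i => T i (x i)) ^ p.toReal ≤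
      C₁ * (C * C₂) * ENNReal.ofReal (rademacherNorm x) ^ p.toReal := by
    calc _ ≤ C₁ * ∫⁻ y, (∑ i, ‖T i (x i) y‖ₑ ^ 2) ^ (p.toReal / 2) ∂(weightedMeasure φ) := h₁ n _
      _ ≤ C₁ * (C * (C₂ * ENNReal.ofReal (rademacherNorm x) ^ p.toReal)) := by
          rw [hsq]
          gcongr
          exact (hb n a k x hk hkN hg).trans (by gcongr; exact h₂ n x)
      _ = _ := by ring
  have hroot : ENNReal.ofReal (rademacherNorm fun i => T i (x i)) ≤
      K * ENNReal.ofReal (rademacherNorm x) := by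
    have := ENNReal.rpow_le_rpow key (by positivity : 0 ≤ 1 / p.toReal)
    rwa [ENNReal.mul_rpow_of_nonneg _ _ (by positivity), ← ENNReal.rpow_mul, ← ENNReal.rpow_mul,
      mul_one_div_cancel hq0.ne', ENNReal.rpow_one, ENNReal.rpow_one] at this
  rw [← ENNReal.ofReal_toReal hK, ← ENNReal.ofReal_mul ENNReal.toReal_nonneg] at hroot
  exact (ENNReal.ofReal_le_ofReal_iff
    (mul_nonneg ENNReal.toReal_nonneg (Real.sqrt_nonneg _))).1 hroot
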